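/- Let $A$ be a finite set of monadic predicate symbols. Formulas of $\mathtt{FOE}^{\infty}(A)$ are given by the grammar \[ \varphi ::= \top \mid \bot \mid a(x) \mid \neg a(x) \mid x \approx y \mid x \not\approx y \mid \varphi \lor \varphi \mid \varphi \land \varphi \mid \exists x.\varphi \mid \forall x.\varphi \mid \exists^\infty x.\varphi \mid \forall^\infty x.\varphi , \] where $a \in A$ and $x, y$ range over a countably infinite set of individual variables. $\mathtt{FOE}(A)$ is the fragment without $\exists^\infty$ and $\forall^\infty$, and $\mathtt{M}(A)$ is the fragment of $\mathtt{FOE}(A)$ without $\approx$ and $\not\approx$. A sentence is a formula without free variables. For $\mathcal{L} \in \{\mathtt{M}, \mathtt{FOE}, \mathtt{FOE}^{\infty}\}$, the universal fragment $\mathrm{Univ}(\mathcal{L}(A))$ consists of the formulas of $\mathcal{L}(A)$ in which neither $\exists$ nor $\exists^\infty$ occurs (so, besides atoms, negated atoms, $\top,\bot,\lor,\land$, only $\forall$ and, for $\mathcal{L} = \mathtt{FOE}^\infty$, $\forall^\infty$ are used). A monadic model $\mathbb{D} = (D,V)$ consists of a set $D$, which may be empty, and a map $V : A \to \wp(D)$.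 Truth is defined as usual, where $\exists^\infty x.\varphi$ means that infinitely many $d \in D$ satisfy $\varphi$ and $\forall^\infty x.\varphi$ means that all but finitely many $d \in D$ satisfy $\varphi$; in the empty model, sentences $\exists x.\varphi$ and $\exists^\infty x.\varphi$ are false and sentences $\forall x.\varphi$ and $\forall^\infty x.\varphi$ are true. Two sentences are equivalent, $\varphi \equiv \psi$, if they are true in the same models. A model $(D',V')$ is a submodel of $(D,V)$ if $D' \subseteq D$ and, for all $a \in A$ and $d \in D'$, $d \in V'(a)$ iff $d \in V(a)$. A sentence $\varphi$ is preserved under taking submodels if $\mathbb{D} \models \varphi$ implies $\mathbb{D}' \models \varphi$ whenever $\mathbb{D}'$ is a submodel of $\mathbb{D}$. Theorem. Let $\mathcal{L} \in \{\mathtt{M}, \mathtt{FOE}, \mathtt{FOE}^{\infty}\}$. 1. A sentence $\varphi$ of $\mathcal{L}(A)$ is preserved under taking submodels if and only if it is equivalent to some sentence in $\mathrm{Univ}(\mathcal{L}(A))$. 2. There is a computable map $(\cdot)^{\otimes}$ that sends every sentence $\varphi$ of $\mathcal{L}(A)$ to a sentence $\varphi^{\otimes} \in \mathrm{Univ}(\mathcal{L}(A))$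 such that $\varphi$ is preserved under taking submodels if and only if $\varphi \equiv \varphi^{\otimes}$. 3. It is decidable whether a given sentence of $\mathcal{L}(A)$ is preserved under taking submodels. -/

import Mathlib

universe u v

namespace MonadicPred

/-- Formulas of monadic first-order logic with equality and the quantifiers `∃^∞`, `∀^∞`, in
negation normal form, over the set `A` of monadic predicate symbols; the individual variables are
the natural numbers. -/
inductive Formula (A : Type u) : Type u
  | top : Formula A
  | bot : Formula A
  | pos (a : A) (x : ℕ) : Formula A
  | neg (a : A) (x : ℕ) : Formula A
  | eq (x y : ℕ) : Formula A
  | ne (x y : ℕ) : Formula A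
  | or (φ ψ : Formula A) : Formula A
  | and (φ ψ : Formula A) : Formula A
  | ex (x : ℕ) (φ : Formula A) : Formula A
  | all (x : ℕ) (φ : Formula A) : Formula A
  | exInf (x : ℕ) (φ : Formula A) : Formula A
  | allInf (x : ℕ) (φ : Formula A) : Formula A

/-- The three monadic logics: `M` (first-order logic without equality), `FOE` (first-order logic
with equality) and `FOEInf` (first-order logic with equality, `∃^∞` and `∀^∞`). -/
inductive Logic
  | M
  | FOE
  | FOEInf

/-- Does the logic have equality? -/
def Logic.HasEq : Logic → Prop
  | .M => False
  | .FOE => True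
  | .FOEInf => True

/-- Does the logic have the quantifiers `∃^∞` and `∀^∞`? -/
def Logic.HasInf : Logic → Prop
  | .M => False
  | .FOE => False
  | .FOEInf => True

namespace Formula

variable {A : Type u}

/-- `φ.InLang L`: `φ` is a formula of the logic `L`. -/
def InLang (L : Logic) : Formula A → Prop
  | top => True
  | bot => True
  | pos _ _ => True
  | neg _ _ => True
  | eq _ _ => L.HasEq
  | ne _ _ => L.HasEq
  | or φ ψ => φ.InLang L ∧ ψ.InLang L
  | and φ ψ => φ.InLang L ∧ ψ.InLang L
  | ex _ φ => φ.InLang L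
  | all _ φ => φ.InLang L
  | exInf _ φ => L.HasInf ∧ φ.InLang L
  | allInf _ φ => L.HasInf ∧ φ.InLang L

/-- `φ.InUniv L`: `φ` belongs to the universal fragment of the logic `L`. -/
def InUniv (L : Logic) : Formula A → Prop
  | top => True
  | bot => True
  | pos _ _ => True
  | neg _ _ => True
  | eq _ _ => L.HasEq
  | ne _ _ => L.HasEq
  | or φ ψ => φ.InUniv L ∧ ψ.InUniv L
  | and φ ψ => φ.InUniv L ∧ ψ.InUniv L
  | ex _ _ => False
  | all _ φ => φ.InUniv L
  | exInf _ _ => False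
  | allInf _ φ => L.HasInf ∧ φ.InUniv L

/-- The free individual variables of a formula. -/
def freeVars : Formula A → Finset ℕ
  | top => ∅
  | bot => ∅
  | pos _ x => {x}
  | neg _ x => {x}
  | eq x y => {x, y}
  | ne x y => {x, y}
  | or φ ψ => φ.freeVars ∪ ψ.freeVars
  | and φ ψ => φ.freeVars ∪ ψ.freeVars
  | ex x φ => φ.freeVars.erase x
  | all x φ => φ.freeVars.erase x
  | exInf x φ => φ.freeVars.erase x
  | allInf x φ => φ.freeVars.erase x

/-- A sentence is a formula without free variables. -/
def IsSentence (φ : Formula A) : Prop := φ.freeVars = ∅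

end Formula

/-- A monadic model: a domain, possibly empty, with a valuation of the predicate symbols. -/
structure Model (A : Type u) where
  /-- the domain -/
  Dom : Type v
  /-- the valuation -/
  val : A → Set Dom

/-- A homomorphism between monadic models preserves and reflects every predicate. -/
def IsHom {A : Type u} (D D' : Model.{u, v} A) (f : D.Dom → D'.Dom) : Prop :=
  ∀ (a : A) (d : D.Dom), d ∈ D.val a ↔ f d ∈ D'.val a

namespace Formula

variable {A : Type u}

/-- Truth in a model (meant for one with nonempty domain) under an assignment of the variables. -/
def Sat (D : Model.{u, v} A) : (ℕ → D.Dom) → Formula A → Prop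
  | _, top => True
  | _, bot => False
  | g, pos a x => g x ∈ D.val a
  | g, neg a x => g x ∉ D.val a
  | g, eq x y => g x = g y
  | g, ne x y => g x ≠ g y
  | g, or φ ψ => φ.Sat D g ∨ ψ.Sat D g
  | g, and φ ψ => φ.Sat D g ∧ ψ.Sat D g
  | g, ex x φ => ∃ d : D.Dom, φ.Sat D (Function.update g x d)
  | g, all x φ => ∀ d : D.Dom, φ.Sat D (Function.update g x d)
  | g, exInf x φ => {d : D.Dom | φ.Sat D (Function.update g x d)}.Infinite
  | g, allInf x φ => {d : D.Dom | ¬ φ.Sat D (Function.update g x d)}.Finite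

/-- Truth of a sentence in the empty model: existentially quantified sentences are false there and
universally quantified ones are true. Atomic formulas with a variable do not occur in a sentence
outside the scope of quantifiers; their value here is immaterial. -/
def TrueInEmpty : Formula A → Prop
  | top => True
  | bot => False
  | pos _ _ => False
  | neg _ _ => False
  | eq _ _ => False
  | ne _ _ => False
  | or φ ψ => φ.TrueInEmpty ∨ ψ.TrueInEmpty
  | and φ ψ => φ.TrueInEmpty ∧ ψ.TrueInEmpty
  | ex _ _ => False
  | all _ _ => True
  | exInf _ _ => False
  | allInf _ _ => True

end Formula

/-- `D.Models φ`: the sentence `φ` is true in `D`. -/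
def Model.Models {A : Type u} (D : Model.{u, v} A) (φ : Formula A) : Prop :=
  (IsEmpty D.Dom ∧ φ.TrueInEmpty) ∨ (Nonempty D.Dom ∧ ∀ g : ℕ → D.Dom, φ.Sat D g)

/-- Two sentences are equivalent if they are true in the same models, the empty one included. -/
def Equivalent {A : Type u} (φ ψ : Formula A) : Prop :=
  ∀ D : Model.{u, v} A, D.Models φ ↔ D.Models ψ

/-- `φ` is preserved under taking submodels: if `φ` is true in `D`, then it is true in every model
`D'` whose domain is a (possibly empty) subset of the domain of `D` and whose inclusion map into
`D` is a homomorphism. -/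
def PreservedUnderSubmodels {A : Type u} (φ : Formula A) : Prop :=
  ∀ (D : Model.{u, v} A) (S : Set D.Dom) (W : A → Set S),
    IsHom (Model.mk S W) D Subtype.val → D.Models φ → (Model.mk S W).Models φ

namespace Formula

variable {A : Type u}

/-- The Gödel number of a formula. -/
def code [Encodable A] : Formula A → ℕ
  | top => Nat.pair 0 0
  | bot => Nat.pair 1 0
  | pos a x => Nat.pair 2 (Nat.pair (Encodable.encode a) x)
  | neg a x => Nat.pair 3 (Nat.pair (Encodable.encode a) x)
  | eq x y => Nat.pair 4 (Nat.pair x y)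
  | ne x y => Nat.pair 5 (Nat.pair x y)
  | or φ ψ => Nat.pair 6 (Nat.pair φ.code ψ.code)
  | and φ ψ => Nat.pair 7 (Nat.pair φ.code ψ.code)
  | ex x φ => Nat.pair 8 (Nat.pair x φ.code)
  | all x φ => Nat.pair 9 (Nat.pair x φ.code)
  | exInf x φ => Nat.pair 10 (Nat.pair x φ.code)
  | allInf x φ => Nat.pair 11 (Nat.pair x φ.code)

theorem code_injective [Encodable A] : Function.Injective (code : Formula A → ℕ) := by
  intro φ
  induction φ with
  | top => intro ψ h; cases ψ <;> simp_all [code, Nat.pair_eq_pair]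
  | bot => intro ψ h; cases ψ <;> simp_all [code, Nat.pair_eq_pair]
  | pos a x => intro ψ h; cases ψ <;> simp_all [code, Nat.pair_eq_pair]
  | neg a x => intro ψ h; cases ψ <;> simp_all [code, Nat.pair_eq_pair]
  | eq x y => intro ψ h; cases ψ <;> simp_all [code, Nat.pair_eq_pair]
  | ne x y => intro ψ h; cases ψ <;> simp_all [code, Nat.pair_eq_pair]
  | or φ₁ φ₂ ih₁ ih₂ =>
    intro ψ h
    cases ψ <;> simp [code, Nat.pair_eq_pair] at h
    rw [ih₁ h.1, ih₂ h.2]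
  | and φ₁ φ₂ ih₁ ih₂ =>
    intro ψ h
    cases ψ <;> simp [code, Nat.pair_eq_pair] at h
    rw [ih₁ h.1, ih₂ h.2]
  | ex x φ ih =>
    intro ψ h
    cases ψ <;> simp [code, Nat.pair_eq_pair] at h
    rw [h.1, ih h.2]
  | all x φ ih =>
    intro ψ h
    cases ψ <;> simp [code, Nat.pair_eq_pair] at h
    rw [h.1, ih h.2]
  | exInf x φ ih =>
    intro ψ h
    cases ψ <;> simp [code, Nat.pair_eq_pair] at h
    rw [h.1, ih h.2]
  | allInf x φ ih =>
    intro ψ h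
    cases ψ <;> simp [code, Nat.pair_eq_pair] at h
    rw [h.1, ih h.2]

/-- How being the Gödel number `Nat.pair k m` of a formula reduces to smaller numbers. -/
theorem isCode_iff [Encodable A] (k m : ℕ) :
    Nat.pair k m ∈ Set.range (code : Formula A → ℕ) ↔
      (k < 2 ∧ m = 0) ∨
      ((k = 2 ∨ k = 3) ∧ m.unpair.1 ∈ Set.range (Encodable.encode : A → ℕ)) ∨
      (k = 4 ∨ k = 5) ∨
      ((k = 6 ∨ k = 7) ∧ m.unpair.1 ∈ Set.range (code : Formula A → ℕ) ∧
        m.unpair.2 ∈ Set.range (code : Formula A → ℕ)) ∨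
      ((8 ≤ k ∧ k < 12) ∧ m.unpair.2 ∈ Set.range (code : Formula A → ℕ)) := by
  constructor
  · rintro ⟨φ, h⟩
    cases φ <;> simp only [code, Nat.pair_eq_pair] at h <;> obtain ⟨rfl, rfl⟩ := h <;> simp
  · obtain ⟨⟨p, q⟩, rfl⟩ : ∃ pq : ℕ × ℕ, Nat.pair pq.1 pq.2 = m := ⟨m.unpair, Nat.pair_unpair m⟩
    simp only [Nat.unpair_pair]
    rintro (⟨hk, hm⟩ | ⟨hk, a, rfl⟩ | hk | ⟨hk, ⟨φ, rfl⟩, ψ, rfl⟩ | ⟨hk, φ, rfl⟩)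
    · rw [hm]
      have : k = 0 ∨ k = 1 := by omega
      rcases this with rfl | rfl
      exacts [⟨top, rfl⟩, ⟨bot, rfl⟩]
    · rcases hk with rfl | rfl
      exacts [⟨pos a q, rfl⟩, ⟨neg a q, rfl⟩]
    · rcases hk with rfl | rfl
      exacts [⟨eq p q, rfl⟩, ⟨ne p q, rfl⟩]
    · rcases hk with rfl | rfl
      exacts [⟨or φ ψ, rfl⟩, ⟨and φ ψ, rfl⟩]
    · have : k = 8 ∨ k = 9 ∨ k = 10 ∨ k = 11 := by omega
      rcases this with rfl | rfl | rfl | rfl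
      exacts [⟨ex p φ, rfl⟩, ⟨all p φ, rfl⟩, ⟨exInf p φ, rfl⟩, ⟨allInf p φ, rfl⟩]

/-- The set of Gödel numbers of formulas is primitive recursive. -/
theorem primrecPred_isCode [Primcodable A] :
    PrimrecPred (fun n : ℕ => n ∈ Set.range (code : Formula A → ℕ)) := by
  classical
  refine ⟨inferInstance, ?_⟩
  have get : ∀ {f : Unit × List Bool → ℕ}, Primrec f →
      PrimrecPred fun p : Unit × List Bool => p.2.getD (f p) false = true := fun hf =>
    PrimrecPred.comp (p := fun b : Bool => b = true)
      (Primrec.eq.comp .id (.const true)) ((Primrec.list_getD false).comp .snd hf)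
  have hk : Primrec fun p : Unit × List Bool => p.2.length.unpair.1 :=
    Primrec.fst.comp (Primrec.unpair.comp (Primrec.list_length.comp .snd))
  have hm : Primrec fun p : Unit × List Bool => p.2.length.unpair.2 :=
    Primrec.snd.comp (Primrec.unpair.comp (Primrec.list_length.comp .snd))
  have hm1 := Primrec.fst.comp (Primrec.unpair.comp hm)
  have hm2 := Primrec.snd.comp (Primrec.unpair.comp hm)
  have eqk (c : ℕ) : PrimrecPred fun p : Unit × List Bool => p.2.length.unpair.1 = c :=
    Primrec.eq.comp hk (.const c)
  have ltk (c : ℕ) : PrimrecPred fun p : Unit × List Bool => p.2.length.unpair.1 < c :=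
    Primrec.nat_lt.comp hk (.const c)
  have lek (c : ℕ) : PrimrecPred fun p : Unit × List Bool => c ≤ p.2.length.unpair.1 :=
    Primrec.nat_le.comp (.const c) hk
  have hP : PrimrecPred fun p : Unit × List Bool =>
      (p.2.length.unpair.1 < 2 ∧ p.2.length.unpair.2 = 0) ∨
      ((p.2.length.unpair.1 = 2 ∨ p.2.length.unpair.1 = 3) ∧
        p.2.length.unpair.2.unpair.1 ∈ Set.range (Encodable.encode : A → ℕ)) ∨
      (p.2.length.unpair.1 = 4 ∨ p.2.length.unpair.1 = 5) ∨
      ((p.2.length.unpair.1 = 6 ∨ p.2.length.unpair.1 = 7) ∧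
        p.2.getD p.2.length.unpair.2.unpair.1 false = true ∧
        p.2.getD p.2.length.unpair.2.unpair.2 false = true) ∨
      ((8 ≤ p.2.length.unpair.1 ∧ p.2.length.unpair.1 < 12) ∧
        p.2.getD p.2.length.unpair.2.unpair.2 false = true) :=
    ((ltk 2).and (Primrec.eq.comp hm (.const 0))).or <|
    (((eqk 2).or (eqk 3)).and ((Primcodable.mem_range_encode (α := A)).comp hm1)).or <|
    ((eqk 4).or (eqk 5)).or <|
    (((eqk 6).or (eqk 7)).and ((get hm1).and (get hm2))).or <|
    ((lek 8).and (ltk 12)).and (get hm2)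
  have key := Primrec.nat_strong_rec
    (fun (_ : Unit) n => decide (n ∈ Set.range (code : Formula A → ℕ)))
    (Primrec.option_some.comp hP.decide).to₂ ?_
  · exact key.comp (.const ()) .id
  · intro _ n
    have hget : ∀ j < n, (((List.range n).map
        fun i => decide (i ∈ Set.range (code : Formula A → ℕ))).getD j false = true ↔
        j ∈ Set.range (code : Formula A → ℕ)) := by
      intro j hj
      simp [List.getD_eq_getElem?_getD, hj]
    obtain ⟨k, m, rfl⟩ : ∃ k m : ℕ, Nat.pair k m = n := ⟨_, _, Nat.pair_unpair n⟩
    congr 1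
    rw [decide_eq_decide, isCode_iff]
    simp only [List.length_map, List.length_range, Nat.unpair_pair]
    have h1 : m.unpair.1 ≤ m := Nat.unpair_left_le m
    have h2 : m.unpair.2 ≤ m := Nat.unpair_right_le m
    have h3 : k + m ≤ Nat.pair k m := Nat.add_le_pair k m
    refine or_congr Iff.rfl (or_congr Iff.rfl (or_congr Iff.rfl (or_congr ?_ ?_)))
    · refine and_congr_right fun hk => ?_
      rw [hget _ (by omega), hget _ (by omega)]
    · refine and_congr_right fun hk => ?_
      rw [hget _ (by omega)]

/-- Formulas are a type on which computability makes sense, through their Gödel numbers. -/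
noncomputable instance instPrimcodable [Primcodable A] : Primcodable (Formula A) :=
  letI : DecidablePred fun n : ℕ => n ∈ Set.range (code : Formula A → ℕ) := Classical.decPred _
  letI : Primcodable {n : ℕ // n ∈ Set.range (code : Formula A → ℕ)} :=
    Primcodable.subtype primrecPred_isCode
  Primcodable.ofEquiv {n : ℕ // n ∈ Set.range (code : Formula A → ℕ)}
    (Equiv.ofInjective code code_injective)

theorem encode_eq_code [Primcodable A] (φ : Formula A) : Encodable.encode φ = φ.code := rfl

end Formula

end MonadicPred

/-!
The truth of a sentence `φ` in a monadic model depends only on the *profile* of the model at a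
large enough threshold `K`: for each type `τ ⊆ A`, the number of elements of type `τ`, cut off at
`K` if it is finite, with infinity kept apart as the value `K + 1`.  To see this, `∃^∞` is first
made a first-order quantifier: elements of the same type that are not named by a variable are
interchangeable, so infinitely many elements satisfy `φ` if and only if some unnamed element of an
infinite type does (`Model.flag_sat`).  Then pebble games apply, between the model and a finite
model with the same profile whose types are merely flagged as infinite or not
(`FlaggedModel.Similar.holds`, `Model.models_iff_profile`).  The Gödel number of `φ` bounds both its
variables and its quantifier rank, so `K = φ.code + 1` is large enough.

Profiles shrink pointwise when passing to submodels, and every pair of comparable profiles comes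
from a model and a submodel.  Hence `φ` is preserved if and only if the finite set of profiles at
which it holds is downward closed (`Model.preserved_iff_profile`).  A downward closed set of
profiles is defined by the disjunction over its members `v` of the conjunctions over the types `τ`
of "at most `v τ` elements have type `τ`" (or, if `v τ = K`, "finitely many", with `∀^∞`), which is
a universal sentence.  The logics `M` and `FOE` cannot state every such bound, but neither can they
tell `v τ` from the next larger number for which they can state it (`Logic.close`); this gives the
universal equivalent of a preserved sentence (`Formula.exists_inUniv_of_preserved`).

As profiles and the finite flagged models they describe are finite objects, truth at a profile is
primitive recursive (`primrecRel_listHolds`), by recursion on the formula with truth tables as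
values, and therefore so are preservation and equivalence.  The map `φ ↦ φ^⊗` searches for a
universal sentence equivalent to `φ` if `φ` is preserved, and returns `⊤` otherwise: a sentence that
is not preserved is equivalent to no universal sentence.
-/

universe w

/-! ### Truth in terms of interchangeable elements -/

namespace MonadicPred
open Function

theorem Logic.HasInf.hasEq {L : Logic} (h : L.HasInf) : L.HasEq := by
  cases L <;> trivial

namespace Formula
variable {A : Type u}

/-- `FOEInf` is the language of all formulas. -/
theorem inLang_foeInf (φ : Formula A) : φ.InLang .FOEInf := by
  induction φ with
  | top | bot | pos | neg | eq | ne => trivial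
  | or φ ψ ih₁ ih₂ | and φ ψ ih₁ ih₂ => exact ⟨ih₁, ih₂⟩
  | ex x φ ih | all x φ ih => exact ih
  | exInf x φ ih | allInf x φ ih => exact ⟨trivial, ih⟩

theorem lt_code_of_mem_freeVars [Encodable A] {φ : Formula A} {x : ℕ} (hx : x ∈ φ.freeVars) :
    x < φ.code := by
  induction φ with
  | top | bot => simp [freeVars] at hx
  | pos a y | neg a y =>
    simp only [freeVars, Finset.mem_singleton] at hx
    have h1 := Nat.add_le_pair 2 (Nat.pair (Encodable.encode a) y)
    have h2 := Nat.add_le_pair 3 (Nat.pair (Encodable.encode a) y)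
    have h3 := Nat.add_le_pair (Encodable.encode a) y
    simp only [code]
    omega
  | eq y z | ne y z =>
    simp only [freeVars, Finset.mem_insert, Finset.mem_singleton] at hx
    have h1 := Nat.add_le_pair 4 (Nat.pair y z)
    have h2 := Nat.add_le_pair 5 (Nat.pair y z)
    have h3 := Nat.add_le_pair y z
    simp only [code]
    omega
  | or φ ψ ih₁ ih₂ | and φ ψ ih₁ ih₂ =>
    simp only [freeVars, Finset.mem_union] at hx
    have h1 := Nat.add_le_pair 6 (Nat.pair φ.code ψ.code)
    have h2 := Nat.add_le_pair 7 (Nat.pair φ.code ψ.code)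
    have h3 := Nat.add_le_pair φ.code ψ.code
    simp only [code]
    rcases hx with hx | hx
    · have := ih₁ hx; omega
    · have := ih₂ hx; omega
  | ex y φ ih | all y φ ih | exInf y φ ih | allInf y φ ih =>
    simp only [freeVars, Finset.mem_erase] at hx
    have h0 := ih hx.2
    have h1 := Nat.right_le_pair y φ.code
    simp only [code]
    exact h0.trans_le (h1.trans (Nat.right_le_pair _ _))

theorem code_lt_binary [Encodable A] (k : ℕ) (hk : 0 < k) (φ ψ : Formula A) :
    φ.code < Nat.pair k (Nat.pair φ.code ψ.code) ∧
      ψ.code < Nat.pair k (Nat.pair φ.code ψ.code) := by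
  have h1 := Nat.add_le_pair k (Nat.pair φ.code ψ.code)
  have h2 := Nat.add_le_pair φ.code ψ.code
  omega

theorem code_lt_quantifier [Encodable A] (k : ℕ) (hk : 0 < k) (x : ℕ) (φ : Formula A) :
    x < Nat.pair k (Nat.pair x φ.code) ∧ φ.code < Nat.pair k (Nat.pair x φ.code) := by
  have h1 := Nat.add_le_pair k (Nat.pair x φ.code)
  have h2 := Nat.add_le_pair x φ.code
  omega

/-- Truth depends only on the values of the free variables. -/
theorem sat_congr (D : Model.{u, v} A) {φ : Formula A} {g g' : ℕ → D.Dom}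
    (h : ∀ x ∈ φ.freeVars, g x = g' x) : φ.Sat D g ↔ φ.Sat D g' := by
  induction φ generalizing g g' with
  | top | bot => rfl
  | pos a x | neg a x =>
    simp only [freeVars, Finset.mem_singleton, forall_eq] at h
    simp only [Sat, h]
  | eq x y | ne x y =>
    simp only [Sat, h x (by simp [freeVars]), h y (by simp [freeVars])]
  | or φ ψ ih₁ ih₂ | and φ ψ ih₁ ih₂ =>
    simp only [freeVars, Finset.mem_union] at h
    simp only [Sat, ih₁ fun x hx => h x (.inl hx), ih₂ fun x hx => h x (.inr hx)]
  | ex x φ ih | all x φ ih | exInf x φ ih | allInf x φ ih =>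
    have key : ∀ d, φ.Sat D (update g x d) ↔ φ.Sat D (update g' x d) := by
      refine fun d => ih fun y hy => ?_
      by_cases hyx : y = x
      · subst hyx; simp
      · simpa [hyx] using h y (by simp [freeVars, hyx, hy])
    simp only [Sat, key]

/-- Truth is invariant under automorphisms. -/
theorem sat_comp_equiv (D : Model.{u, v} A) (σ : D.Dom ≃ D.Dom)
    (hσ : ∀ a d, σ d ∈ D.val a ↔ d ∈ D.val a) (φ : Formula A) (g : ℕ → D.Dom) :
    φ.Sat D (σ ∘ g) ↔ φ.Sat D g := by
  have hfin : ∀ s : Set D.Dom, s.Finite ↔ (σ ⁻¹' s).Finite := fun s =>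
    ⟨fun h => h.preimage σ.injective.injOn, fun h => by simpa using h.image σ⟩
  induction φ generalizing g with
  | top | bot => rfl
  | pos a x | neg a x => simp [Sat, hσ]
  | eq x y | ne x y => simp [Sat]
  | or φ ψ ih₁ ih₂ | and φ ψ ih₁ ih₂ => simp only [Sat, ih₁, ih₂]
  | ex x φ ih | all x φ ih | exInf x φ ih | allInf x φ ih =>
    have e : ∀ d, φ.Sat D (update (σ ∘ g) x (σ d)) ↔ φ.Sat D (update g x d) := by
      intro d
      rw [← comp_update]
      exact ih _
    simp only [Sat, ← e]
    first
    | exact σ.surjective.exists (p := fun d => φ.Sat D (update (σ ∘ g) x d))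
    | exact σ.surjective.forall (p := fun d => φ.Sat D (update (σ ∘ g) x d))
    | exact (hfin {d | φ.Sat D (update (σ ∘ g) x d)}).not
    | exact hfin {d | ¬ φ.Sat D (update (σ ∘ g) x d)}

end Formula

/-- A set of elements, each with a type (the set of predicates true of it) and a flag `big`
that says whether its type is to be regarded as realized infinitely often.  The elements outside
the carrier serve as junk values. -/
structure FlaggedModel (A : Type u) where
  /-- the ambient type of elements -/
  Dom : Type w
  /-- the elements over which quantifiers range -/
  carrier : Set Dom
  /-- the predicates that hold of an element -/
  ty : Dom → Set A
  /-- the elements whose type counts as infinite -/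
  big : Dom → Prop

namespace FlaggedModel
variable {A : Type u}

/-- The element `d` differs from the values of all variables below `N` other than `x`. -/
def Fresh {D : Type w} (N : ℕ) (g : ℕ → D) (x : ℕ) (d : D) : Prop := ∀ y < N, y ≠ x → g y ≠ d

/-- Truth in a flagged model of a formula with variables below `N`: `∃^∞ x. φ` is read as
"some fresh element of an infinite type satisfies `φ`", and `∀^∞ x. φ` dually, which makes both
first-order quantifiers. -/
def Sat (F : FlaggedModel.{u, w} A) (N : ℕ) : (ℕ → F.Dom) → Formula A → Prop
  | _, .top => True
  | _, .bot => False
  | g, .pos a x => a ∈ F.ty (g x)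
  | g, .neg a x => a ∉ F.ty (g x)
  | g, .eq x y => g x = g y
  | g, .ne x y => g x ≠ g y
  | g, .or φ ψ => F.Sat N g φ ∨ F.Sat N g ψ
  | g, .and φ ψ => F.Sat N g φ ∧ F.Sat N g ψ
  | g, .ex x φ => ∃ d ∈ F.carrier, F.Sat N (update g x d) φ
  | g, .all x φ => ∀ d ∈ F.carrier, F.Sat N (update g x d) φ
  | g, .exInf x φ => ∃ d ∈ F.carrier, (F.big d ∧ Fresh N g x d) ∧ F.Sat N (update g x d) φ
  | g, .allInf x φ => ∀ d ∈ F.carrier, (F.big d ∧ Fresh N g x d) → F.Sat N (update g x d) φ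

/-- Truth of a sentence in a flagged model, whose carrier may be empty. -/
def Holds (F : FlaggedModel.{u, w} A) (N : ℕ) (φ : Formula A) : Prop :=
  (F.carrier = ∅ ∧ φ.TrueInEmpty) ∨ ∃ d ∈ F.carrier, F.Sat N (fun _ => d) φ

end FlaggedModel

/-- An infinite set that does not split types outside a finite set `X` is one that contains an
element outside `X` of an infinite type. -/
theorem infinite_iff_exists_fresh {D : Type v} {T : Type u} [Finite T] (ty : D → T)
    (X : Set D) (hX : X.Finite) (s : Set D)
    (hs : ∀ d ∉ X, ∀ d' ∉ X, ty d = ty d' → d ∈ s → d' ∈ s) :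
    s.Infinite ↔ ∃ d, ({d' | ty d' = ty d}.Infinite ∧ d ∉ X) ∧ d ∈ s := by
  constructor
  · intro h
    obtain ⟨t, ht⟩ : ∃ t, ((s \ X) ∩ ty ⁻¹' {t}).Infinite := by
      by_contra! hfin
      refine h.sdiff hX ((Set.finite_iUnion hfin).subset fun d hd => ?_)
      exact Set.mem_iUnion.2 ⟨ty d, hd, rfl⟩
    obtain ⟨d, ⟨hds, hdX⟩, hdt⟩ := ht.nonempty
    refine ⟨d, ⟨ht.mono fun d' hd' => ?_, hdX⟩, hds⟩
    exact hd'.2.trans hdt.symm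
  · rintro ⟨d, ⟨hd, hdX⟩, hds⟩
    exact (hd.sdiff hX).mono fun d' hd' => hs d hdX d' hd'.2 hd'.1.symm hds

namespace Model
variable {A : Type u}

/-- The set of predicates that hold of an element. -/
def ty (D : Model.{u, v} A) (d : D.Dom) : Set A := {a | d ∈ D.val a}

/-- A monadic model as a flagged model. -/
def flag (D : Model.{u, v} A) : FlaggedModel.{u, v} A where
  Dom := D.Dom
  carrier := Set.univ
  ty := D.ty
  big d := {d' | D.ty d' = D.ty d}.Infinite

/-- Fresh elements of the same type are interchangeable, by a transposition. -/
theorem sat_update_of_fresh [Encodable A] (D : Model.{u, v} A) {N : ℕ} {φ : Formula A}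
    (hφ : φ.code ≤ N) {g : ℕ → D.Dom} {x : ℕ} {d d' : D.Dom} (hd : FlaggedModel.Fresh N g x d)
    (hd' : FlaggedModel.Fresh N g x d') (h : D.ty d = D.ty d') :
    φ.Sat D (update g x d) ↔ φ.Sat D (update g x d') := by
  classical
  rw [← Formula.sat_comp_equiv D (Equiv.swap d d') ?_ φ]
  · refine Formula.sat_congr D fun y hy => ?_
    have hyN := (Formula.lt_code_of_mem_freeVars hy).trans_le hφ
    by_cases hyx : y = x
    · subst hyx; simp
    · simp [hyx, Equiv.swap_apply_of_ne_of_ne (hd y hyN hyx) (hd' y hyN hyx)]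
  · intro a e
    have h : d ∈ D.val a ↔ d' ∈ D.val a := Set.ext_iff.1 h a
    rcases eq_or_ne e d with rfl | h1
    · simp [h]
    rcases eq_or_ne e d' with rfl | h2
    · simp [h]
    rw [Equiv.swap_apply_of_ne_of_ne h1 h2]

/-- Reading `∃^∞` as a first-order quantifier over fresh elements of infinite types does not change
truth in a model. -/
theorem flag_sat [Encodable A] [Finite A] (D : Model.{u, v} A) {N : ℕ} {φ : Formula A}
    (hφ : φ.code ≤ N) (g : ℕ → D.Dom) : D.flag.Sat N g φ ↔ φ.Sat D g := by
  -- Both `∃^∞` and `∀^∞` reduce to this, applied to the set defined by `ψ` or its complement.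
  have key : ∀ (ψ : Formula A), ψ.code ≤ N → ∀ (g : ℕ → D.Dom) (x : ℕ) (s : Set D.Dom),
      (∀ d d', (ψ.Sat D (update g x d) ↔ ψ.Sat D (update g x d')) → d ∈ s → d' ∈ s) →
      (s.Infinite ↔ ∃ d, ({d' | D.ty d' = D.ty d}.Infinite ∧ FlaggedModel.Fresh N g x d) ∧
        d ∈ s) := by
    intro ψ hψ g x s hs
    have hX : ∀ d, FlaggedModel.Fresh N g x d ↔ d ∉ g '' {y | y < N ∧ y ≠ x} := by
      intro d
      simp only [FlaggedModel.Fresh, Set.mem_image, Set.mem_ofPred_eq]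
      grind
    simp only [hX]
    refine infinite_iff_exists_fresh D.ty _ (Set.Finite.image _ ?_) s ?_
    · exact (Set.finite_lt_nat N).subset fun y hy => hy.1
    · intro d hd d' hd' h
      exact hs d d' (D.sat_update_of_fresh hψ ((hX d).2 hd) ((hX d').2 hd') h)
  induction φ generalizing g with
  | top | bot | pos | neg | eq | ne => rfl
  | or φ ψ ih₁ ih₂ | and φ ψ ih₁ ih₂ =>
    simp only [Formula.code] at hφ
    have h6 := Formula.code_lt_binary 6 (by simp) φ ψ
    have h7 := Formula.code_lt_binary 7 (by simp) φ ψ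
    simp only [FlaggedModel.Sat, Formula.Sat, ih₁ (by omega), ih₂ (by omega)]
  | ex x φ ih =>
    have hφ' := (Formula.code_lt_quantifier 8 (by simp) x φ).2.le.trans hφ
    exact ⟨fun ⟨d, _, h⟩ => ⟨d, (ih hφ' _).1 h⟩, fun ⟨d, h⟩ => ⟨d, trivial, (ih hφ' _).2 h⟩⟩
  | all x φ ih =>
    have hφ' := (Formula.code_lt_quantifier 9 (by simp) x φ).2.le.trans hφ
    exact ⟨fun h d => (ih hφ' _).1 (h d trivial), fun h d _ => (ih hφ' _).2 (h d)⟩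
  | exInf x φ ih =>
    have hφ' := (Formula.code_lt_quantifier 10 (by simp) x φ).2.le.trans hφ
    refine Iff.trans ?_
      (key φ hφ' g x {d | φ.Sat D (update g x d)} fun d d' h hd => h.1 hd).symm
    exact ⟨fun ⟨d, _, hb, h⟩ => ⟨d, hb, (ih hφ' _).1 h⟩,
      fun ⟨d, hb, h⟩ => ⟨d, trivial, hb, (ih hφ' _).2 h⟩⟩
  | allInf x φ ih =>
    have hφ' := (Formula.code_lt_quantifier 11 (by simp) x φ).2.le.trans hφ
    have k := key φ hφ' g x {d | ¬ φ.Sat D (update g x d)} fun d d' h hd hd' => hd (h.2 hd')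
    refine Iff.trans ?_ ((not_congr k).symm.trans Set.not_infinite)
    exact ⟨fun h ⟨d, hb, hn⟩ => hn ((ih hφ' _).1 (h d trivial hb)),
      fun h d _ hb => (ih hφ' _).2 (by_contra fun hn => h ⟨d, hb, hn⟩)⟩

/-- Truth of sentences in a model and in its flagged version agree. -/
theorem flag_holds [Encodable A] [Finite A] (D : Model.{u, v} A) {N : ℕ} {φ : Formula A}
    (hφ : φ.code ≤ N) (hs : φ.IsSentence) : D.flag.Holds N φ ↔ D.Models φ := by
  have h0 : D.flag.carrier = ∅ ↔ IsEmpty D.Dom := Set.univ_eq_empty_iff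
  rw [FlaggedModel.Holds, Models, h0]
  refine or_congr Iff.rfl ?_
  have hc : ∀ g g' : ℕ → D.Dom, φ.Sat D g ↔ φ.Sat D g' := fun g g' =>
    Formula.sat_congr D (by simp [show φ.freeVars = ∅ from hs])
  constructor
  · rintro ⟨d, -, hd⟩
    exact ⟨⟨d⟩, fun g => (hc _ _).1 ((D.flag_sat hφ _).1 hd)⟩
  · rintro ⟨⟨d⟩, h⟩
    exact ⟨d, trivial, (D.flag_sat hφ _).2 (h _)⟩

end Model
end MonadicPred

/-! ### Pebble games and profiles -/

namespace MonadicPred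
open Function

namespace FlaggedModel
variable {A : Type u}

/-- A graded back-and-forth system for the logic `L` between two flagged models: `B r g g'` says
that the assignments `g` and `g'` of the variables below `N` agree on atomic formulas of `L` and
that this can be maintained while `r` more quantifiers are read. -/
structure BackAndForth (L : Logic) (N : ℕ) (F : FlaggedModel.{u, v} A)
    (F' : FlaggedModel.{u, w} A) (B : ℕ → (ℕ → F.Dom) → (ℕ → F'.Dom) → Prop) : Prop where
  ty : ∀ {r g g'}, B r g g' → ∀ x < N, F.ty (g x) = F'.ty (g' x)
  eq : ∀ {r g g'}, L.HasEq → B r g g' → ∀ x < N, ∀ y < N, (g x = g y ↔ g' x = g' y)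
  forth : ∀ {r g g'}, B (r + 1) g g' → ∀ x < N, ∀ d ∈ F.carrier, ∃ d' ∈ F'.carrier,
    B r (update g x d) (update g' x d') ∧ (L.HasInf → (F.big d ↔ F'.big d'))
  back : ∀ {r g g'}, B (r + 1) g g' → ∀ x < N, ∀ d' ∈ F'.carrier, ∃ d ∈ F.carrier,
    B r (update g x d) (update g' x d') ∧ (L.HasInf → (F.big d ↔ F'.big d'))

namespace BackAndForth
variable {L : Logic} {N : ℕ} {F : FlaggedModel.{u, v} A} {F' : FlaggedModel.{u, w} A}
  {B : ℕ → (ℕ → F.Dom) → (ℕ → F'.Dom) → Prop}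

theorem fresh_iff (h : BackAndForth L N F F' B) (hL : L.HasEq) {r : ℕ} {g : ℕ → F.Dom}
    {g' : ℕ → F'.Dom} {x : ℕ} (hx : x < N) {d : F.Dom} {d' : F'.Dom}
    (hB : B r (update g x d) (update g' x d')) : Fresh N g x d ↔ Fresh N g' x d' := by
  refine forall_congr' fun y => forall_congr' fun hy => forall_congr' fun hyx => not_congr ?_
  simpa [hyx] using h.eq hL hB y hy x hx

/-- The Gödel number of a formula bounds its variables and its quantifier rank, so it can serve as
the number of rounds. -/
theorem sat [Encodable A] (h : BackAndForth L N F F' B) {φ : Formula A} (hL : φ.InLang L)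
    (hN : φ.code ≤ N) {r : ℕ} (hr : φ.code ≤ r) {g : ℕ → F.Dom} {g' : ℕ → F'.Dom}
    (hB : B r g g') (hφ : F.Sat N g φ) : F'.Sat N g' φ := by
  induction φ generalizing r g g' with
  | top => trivial
  | bot => exact hφ
  | pos a x | neg a x =>
    have hx : x < N :=
      (Formula.lt_code_of_mem_freeVars (by simp [Formula.freeVars])).trans_le hN
    simpa only [Sat, h.ty hB x hx] using hφ
  | eq x y | ne x y =>
    have hx : x < N :=
      (Formula.lt_code_of_mem_freeVars (by simp [Formula.freeVars])).trans_le hN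
    have hy : y < N :=
      (Formula.lt_code_of_mem_freeVars (by simp [Formula.freeVars])).trans_le hN
    simpa only [Sat, h.eq hL hB x hx y hy, ne_eq] using hφ
  | or φ ψ ih₁ ih₂ =>
    obtain ⟨h₁, h₂⟩ := Formula.code_lt_binary 6 (by simp) φ ψ
    exact hφ.imp (ih₁ hL.1 (h₁.le.trans hN) (h₁.le.trans hr) hB)
      (ih₂ hL.2 (h₂.le.trans hN) (h₂.le.trans hr) hB)
  | and φ ψ ih₁ ih₂ =>
    obtain ⟨h₁, h₂⟩ := Formula.code_lt_binary 7 (by simp) φ ψ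
    exact hφ.imp (ih₁ hL.1 (h₁.le.trans hN) (h₁.le.trans hr) hB)
      (ih₂ hL.2 (h₂.le.trans hN) (h₂.le.trans hr) hB)
  | ex x φ ih =>
    obtain ⟨hx, hc⟩ := Formula.code_lt_quantifier 8 (by simp) x φ
    obtain ⟨r, rfl⟩ := Nat.exists_eq_add_of_lt ((Nat.zero_le _).trans_lt (hx.trans_le hr))
    rw [zero_add] at hB hr
    obtain ⟨d, hd, hφ⟩ := hφ
    obtain ⟨d', hd', hB', -⟩ := h.forth hB x (hx.trans_le hN) d hd
    exact ⟨d', hd', ih hL (hc.le.trans hN) (Nat.le_of_lt_succ (hc.trans_le hr)) hB' hφ⟩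
  | all x φ ih =>
    obtain ⟨hx, hc⟩ := Formula.code_lt_quantifier 9 (by simp) x φ
    obtain ⟨r, rfl⟩ := Nat.exists_eq_add_of_lt ((Nat.zero_le _).trans_lt (hx.trans_le hr))
    rw [zero_add] at hB hr
    intro d' hd'
    obtain ⟨d, hd, hB', -⟩ := h.back hB x (hx.trans_le hN) d' hd'
    exact ih hL (hc.le.trans hN) (Nat.le_of_lt_succ (hc.trans_le hr)) hB' (hφ d hd)
  | exInf x φ ih =>
    obtain ⟨hx, hc⟩ := Formula.code_lt_quantifier 10 (by simp) x φ
    obtain ⟨r, rfl⟩ := Nat.exists_eq_add_of_lt ((Nat.zero_le _).trans_lt (hx.trans_le hr))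
    rw [zero_add] at hB hr
    obtain ⟨d, hd, ⟨hb, hf⟩, hφ⟩ := hφ
    obtain ⟨d', hd', hB', hbig⟩ := h.forth hB x (hx.trans_le hN) d hd
    exact ⟨d', hd', ⟨(hbig hL.1).1 hb, (h.fresh_iff hL.1.hasEq (hx.trans_le hN) hB').1 hf⟩,
      ih hL.2 (hc.le.trans hN) (Nat.le_of_lt_succ (hc.trans_le hr)) hB' hφ⟩
  | allInf x φ ih =>
    obtain ⟨hx, hc⟩ := Formula.code_lt_quantifier 11 (by simp) x φ
    obtain ⟨r, rfl⟩ := Nat.exists_eq_add_of_lt ((Nat.zero_le _).trans_lt (hx.trans_le hr))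
    rw [zero_add] at hB hr
    rintro d' hd' ⟨hb, hf⟩
    obtain ⟨d, hd, hB', hbig⟩ := h.back hB x (hx.trans_le hN) d' hd'
    exact ih hL.2 (hc.le.trans hN) (Nat.le_of_lt_succ (hc.trans_le hr)) hB'
      (hφ d hd ⟨(hbig hL.1).2 hb, (h.fresh_iff hL.1.hasEq (hx.trans_le hN) hB').2 hf⟩)

theorem holds [Encodable A] (h : BackAndForth L N F F' B)
    (h0 : F.carrier = ∅ → F'.carrier = ∅)
    (hB : ∀ d ∈ F.carrier, ∃ d' ∈ F'.carrier, B N (fun _ => d) (fun _ => d'))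
    {φ : Formula A} (hL : φ.InLang L) (hN : φ.code ≤ N) (hφ : F.Holds N φ) : F'.Holds N φ := by
  obtain ⟨he, hφ⟩ | ⟨d, hd, hφ⟩ := hφ
  · exact .inl ⟨h0 he, hφ⟩
  · obtain ⟨d', hd', hB⟩ := hB d hd
    exact .inr ⟨d', hd', h.sat hL hN hN hB hφ⟩

end BackAndForth

/-- The number of elements of a given type. -/
noncomputable def count (F : FlaggedModel.{u, v} A) (τ : Set A) : ℕ∞ :=
  {d | d ∈ F.carrier ∧ F.ty d = τ}.encard

theorem count_eq_zero {F : FlaggedModel.{u, v} A} {τ : Set A} :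
    F.count τ = 0 ↔ ∀ d ∈ F.carrier, F.ty d ≠ τ := by
  rw [count, Set.encard_eq_zero, Set.eq_empty_iff_forall_notMem]
  exact forall_congr' fun d => not_and

/-- The answer to a move of the pebble game: if two sets have the same size up to `K` and fewer
than `K` pairs of pebbles are on the board, then a new element of one is matched by a new element
of the other. -/
theorem exists_new {D : Type v} {D' : Type w} {K : ℕ} {s : Set D} {s' : Set D'}
    (h : min (K : ℕ∞) s.encard = min (K : ℕ∞) s'.encard) (R : Finset (D × D'))
    (hR : R.card < K) (hs : ∀ p ∈ R, (p.1 ∈ s ↔ p.2 ∈ s'))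
    (hinj : ∀ p ∈ R, ∀ q ∈ R, p.1 = q.1 ↔ p.2 = q.2) {d : D} (hd : d ∈ s)
    (hdR : ∀ p ∈ R, p.1 ≠ d) : ∃ d' ∈ s', ∀ p ∈ R, p.2 ≠ d' := by
  classical
  by_contra! hcon
  -- The pairs `Q` on the board cover all of `s'`, but `s` has at least one more element than `Q`,
  -- and this difference is visible below `K`.
  set Q := R.filter fun p => p.1 ∈ s with hQ
  have h1 : s'.encard ≤ Q.card := by
    rw [← Set.encard_coe_eq_coe_finsetCard]
    refine (Set.encard_le_encard fun d' hd' => ?_).trans (Set.encard_image_le Prod.snd _)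
    obtain ⟨p, hp, rfl⟩ := hcon d' hd'
    exact ⟨p, by simp [hQ, hp, (hs p hp).2 hd'], rfl⟩
  have h2 : ((Q.card + 1 : ℕ) : ℕ∞) ≤ s.encard := by
    have hi : (Q.image Prod.fst).card = Q.card := by
      refine Finset.card_image_of_injOn fun p hp q hq hpq => Prod.ext hpq ?_
      exact (hinj p (Finset.mem_filter.1 hp).1 q (Finset.mem_filter.1 hq).1).1 hpq
    have hn : d ∉ Q.image Prod.fst := by
      intro hmem
      obtain ⟨p, hp, hpd⟩ := Finset.mem_image.1 hmem
      exact hdR p (Finset.mem_filter.1 hp).1 hpd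
    rw [← hi, ← Finset.card_insert_of_notMem hn, ← Set.encard_coe_eq_coe_finsetCard]
    refine Set.encard_le_encard fun e he => ?_
    rcases Finset.mem_insert.1 (Finset.mem_coe.1 he) with rfl | he
    · exact hd
    · obtain ⟨p, hp, rfl⟩ := Finset.mem_image.1 he
      exact (Finset.mem_filter.1 hp).2
  have h3 : Q.card + 1 ≤ K := (Finset.card_filter_le _ _).trans_lt hR
  have h4 : ((Q.card + 1 : ℕ) : ℕ∞) ≤ Q.card :=
    (le_min (by exact_mod_cast h3) h2).trans (h.le.trans ((min_le_right _ _).trans h1))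
  have : Q.card + 1 ≤ Q.card := by exact_mod_cast h4
  omega

/-- Two flagged models are indistinguishable for the sentences of `L` with code at most `N`: they
realize each type equally often, up to `N + 1`, or realize the same types if `L` has no equality,
and they agree on which types are infinite if `L` can speak about this. -/
structure Similar (L : Logic) (N : ℕ) (F : FlaggedModel.{u, v} A)
    (F' : FlaggedModel.{u, w} A) : Prop where
  zero : ∀ τ, F.count τ = 0 ↔ F'.count τ = 0
  count : L.HasEq → ∀ τ, min ((N + 1 : ℕ) : ℕ∞) (F.count τ) = min ((N + 1 : ℕ) : ℕ∞) (F'.count τ)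
  big : L.HasInf → ∀ d ∈ F.carrier, ∀ d' ∈ F'.carrier, F.ty d = F'.ty d' → (F.big d ↔ F'.big d')

theorem Similar.symm {L : Logic} {N : ℕ} {F : FlaggedModel.{u, v} A} {F' : FlaggedModel.{u, w} A}
    (h : Similar L N F F') : Similar L N F' F where
  zero τ := (h.zero τ).symm
  count hL τ := (h.count hL τ).symm
  big hL d hd d' hd' he := (h.big hL d' hd' d hd he.symm).symm

theorem Similar.exists_ty {L : Logic} {N : ℕ} {F : FlaggedModel.{u, v} A}
    {F' : FlaggedModel.{u, w} A} (h : Similar L N F F') {d : F.Dom} (hd : d ∈ F.carrier) :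
    ∃ d' ∈ F'.carrier, F'.ty d' = F.ty d := by
  by_contra! hcon
  exact count_eq_zero.1 ((h.zero _).2 (count_eq_zero.2 hcon)) d hd rfl

theorem Similar.carrier_eq_empty {L : Logic} {N : ℕ} {F : FlaggedModel.{u, v} A}
    {F' : FlaggedModel.{u, w} A} (h : Similar L N F F') (h0 : F.carrier = ∅) :
    F'.carrier = ∅ := by
  refine Set.eq_empty_of_forall_notMem fun d' hd' => ?_
  obtain ⟨d, hd, -⟩ := h.symm.exists_ty hd'
  simp [h0] at hd

/-- The positions of the pebble game with `r` rounds to go: a finite partial isomorphism `R`,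
small enough for every later move to be answered, that contains the values of the variables. -/
def Pebbles (N : ℕ) (F : FlaggedModel.{u, v} A) (F' : FlaggedModel.{u, w} A) (r : ℕ)
    (g : ℕ → F.Dom) (g' : ℕ → F'.Dom) : Prop :=
  ∃ R : Finset (F.Dom × F'.Dom), R.card + r ≤ N + 1 ∧
    (∀ p ∈ R, p.1 ∈ F.carrier ∧ p.2 ∈ F'.carrier ∧ F.ty p.1 = F'.ty p.2) ∧
    (∀ p ∈ R, ∀ q ∈ R, p.1 = q.1 ↔ p.2 = q.2) ∧ ∀ y < N, (g y, g' y) ∈ R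

theorem Pebbles.symm {N : ℕ} {F : FlaggedModel.{u, v} A} {F' : FlaggedModel.{u, w} A} {r : ℕ}
    {g : ℕ → F.Dom} {g' : ℕ → F'.Dom} (h : Pebbles N F F' r g g') : Pebbles N F' F r g' g := by
  obtain ⟨R, h1, h2, h3, h4⟩ := h
  refine ⟨R.map (Equiv.prodComm _ _).toEmbedding, by simpa using h1, ?_, ?_, ?_⟩
  · simp only [Finset.mem_map_equiv, Equiv.prodComm_symm, Equiv.prodComm_apply]
    exact fun p hp => ⟨(h2 _ hp).2.1, (h2 _ hp).1, (h2 _ hp).2.2.symm⟩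
  · simp only [Finset.mem_map_equiv, Equiv.prodComm_symm, Equiv.prodComm_apply]
    exact fun p hp q hq => (h3 _ hp _ hq).symm
  · simpa [Finset.mem_map_equiv] using h4

theorem Similar.pebbles_forth {L : Logic} {N : ℕ} {F : FlaggedModel.{u, v} A}
    {F' : FlaggedModel.{u, w} A} (h : Similar L N F F') (hL : L.HasEq) {r : ℕ} {g : ℕ → F.Dom}
    {g' : ℕ → F'.Dom} (hB : Pebbles N F F' (r + 1) g g') (x : ℕ) {d : F.Dom}
    (hd : d ∈ F.carrier) :
    ∃ d' ∈ F'.carrier, Pebbles N F F' r (update g x d) (update g' x d') ∧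
      F.ty d = F'.ty d' := by
  classical
  obtain ⟨R, h1, h2, h3, h4⟩ := hB
  have hup : ∀ (R' : Finset (F.Dom × F'.Dom)) (d' : F'.Dom), R ⊆ R' → (d, d') ∈ R' →
      ∀ y < N, (update g x d y, update g' x d' y) ∈ R' := by
    intro R' d' hRR hdd y hy
    by_cases hyx : y = x
    · subst hyx; simpa using hdd
    · simpa [hyx] using hRR (h4 y hy)
  by_cases hdR : ∃ p ∈ R, p.1 = d
  · obtain ⟨⟨d₀, d'⟩, hp, rfl⟩ := hdR
    exact ⟨d', (h2 _ hp).2.1, ⟨R, by omega, h2, h3, hup R d' subset_rfl hp⟩, (h2 _ hp).2.2⟩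
  · push Not at hdR
    obtain ⟨d', ⟨hd', hty⟩, hnew⟩ := exists_new (h.count hL (F.ty d)) R (by omega)
      (fun p hp => by simp [(h2 p hp).1, (h2 p hp).2.1, (h2 p hp).2.2])
      h3 (d := d) ⟨hd, rfl⟩ hdR
    refine ⟨d', hd', ⟨insert (d, d') R, ?_, ?_, ?_, hup _ d' (Finset.subset_insert _ _)
      (Finset.mem_insert_self _ _)⟩, hty.symm⟩
    · have := Finset.card_insert_le (d, d') R
      omega
    · intro p hp
      rcases Finset.mem_insert.1 hp with rfl | hp
      · exact ⟨hd, hd', hty.symm⟩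
      · exact h2 p hp
    · intro p hp q hq
      rcases Finset.mem_insert.1 hp with rfl | hp <;> rcases Finset.mem_insert.1 hq with rfl | hq
      · simp
      · simp [(hdR q hq).symm, (hnew q hq).symm]
      · simp [hdR p hp, hnew p hp]
      · exact h3 p hp q hq

theorem Similar.backAndForth_pebbles {L : Logic} {N : ℕ} {F : FlaggedModel.{u, v} A}
    {F' : FlaggedModel.{u, w} A} (h : Similar L N F F') (hL : L.HasEq) :
    BackAndForth L N F F' (Pebbles N F F') where
  ty := fun ⟨_, _, h2, _, h4⟩ x hx => (h2 _ (h4 x hx)).2.2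
  eq := fun _ ⟨_, _, _, h3, h4⟩ x hx y hy => h3 _ (h4 x hx) _ (h4 y hy)
  forth hB x _ d hd := by
    obtain ⟨d', hd', hB', hty⟩ := h.pebbles_forth hL hB x hd
    exact ⟨d', hd', hB', fun hI => h.big hI d hd d' hd' hty⟩
  back hB x _ d' hd' := by
    obtain ⟨d, hd, hB', hty⟩ := h.symm.pebbles_forth hL hB.symm x hd'
    exact ⟨d, hd, hB'.symm, fun hI => h.big hI d hd d' hd' hty.symm⟩

/-- Without equality, elements may be answered by any element of the same type. -/
theorem Similar.backAndForth_ty {L : Logic} {N : ℕ} {F : FlaggedModel.{u, v} A}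
    {F' : FlaggedModel.{u, w} A} (h : Similar L N F F') (hL : ¬ L.HasEq) :
    BackAndForth L N F F' (fun _ g g' => ∀ x < N, F.ty (g x) = F'.ty (g' x)) where
  ty hB := hB
  eq hL' := absurd hL' hL
  forth {r g g'} hB x _ d hd := by
    obtain ⟨d', hd', hty⟩ := h.exists_ty hd
    refine ⟨d', hd', fun y hy => ?_, fun hI => absurd hI.hasEq hL⟩
    by_cases hyx : y = x
    · subst hyx; simp [hty]
    · simp [hyx, hB y hy]
  back {r g g'} hB x _ d' hd' := by
    obtain ⟨d, hd, hty⟩ := h.symm.exists_ty hd'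
    refine ⟨d, hd, fun y hy => ?_, fun hI => absurd hI.hasEq hL⟩
    by_cases hyx : y = x
    · subst hyx; simp [hty]
    · simp [hyx, hB y hy]

/-- Similar flagged models satisfy the same sentences.  The first pebble, on the common value of all
variables, is the reason for counting up to `N + 1`. -/
theorem Similar.holds [Encodable A] {L : Logic} {N : ℕ} {F : FlaggedModel.{u, v} A}
    {F' : FlaggedModel.{u, w} A} (h : Similar L N F F') {φ : Formula A} (hφL : φ.InLang L)
    (hN : φ.code ≤ N) (hφ : F.Holds N φ) : F'.Holds N φ := by
  by_cases hL : L.HasEq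
  · refine (h.backAndForth_pebbles hL).holds h.carrier_eq_empty (fun d hd => ?_) hφL hN hφ
    obtain ⟨d', hd', hty⟩ := h.exists_ty hd
    exact ⟨d', hd', {(d, d')}, by simp [add_comm], by simp [hd, hd', hty], by simp, by simp⟩
  · refine (h.backAndForth_ty hL).holds h.carrier_eq_empty (fun d hd => ?_) hφL hN hφ
    obtain ⟨d', hd', hty⟩ := h.exists_ty hd
    exact ⟨d', hd', fun _ _ => hty.symm⟩

theorem Similar.holds_iff [Encodable A] {L : Logic} {N : ℕ} {F : FlaggedModel.{u, v} A}
    {F' : FlaggedModel.{u, w} A} (h : Similar L N F F') {φ : Formula A} (hφL : φ.InLang L)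
    (hN : φ.code ≤ N) : F.Holds N φ ↔ F'.Holds N φ :=
  ⟨h.holds hφL hN, h.symm.holds hφL hN⟩

/-- The finite flagged model described by a profile `v`: it has `min (v τ) K` elements of type
`τ`, and the type counts as infinite if `v τ = K + 1`. -/
def ofProfile (K : ℕ) (v : Set A → ℕ) : FlaggedModel.{u, u} A where
  Dom := Set A × ℕ
  carrier := {p | p.2 < K ∧ p.2 < v p.1}
  ty p := p.1
  big p := v p.1 = K + 1

theorem count_ofProfile (K : ℕ) (v : Set A → ℕ) (τ : Set A) :
    (ofProfile K v).count τ = (min K (v τ) : ℕ) := by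
  have h : {p : Set A × ℕ | (p.2 < K ∧ p.2 < v p.1) ∧ p.1 = τ} =
      Prod.mk τ '' (Finset.range (min K (v τ)) : Set ℕ) := by
    ext ⟨σ, i⟩
    constructor
    · rintro ⟨⟨h1, h2⟩, rfl⟩
      exact ⟨i, by simpa using ⟨h1, h2⟩, rfl⟩
    · rintro ⟨j, hj, hji⟩
      obtain ⟨rfl, rfl⟩ := Prod.mk.inj hji
      exact ⟨by simpa using hj, rfl⟩
  change Set.encard {p : Set A × ℕ | (p.2 < K ∧ p.2 < v p.1) ∧ p.1 = τ} = _
  rw [h, (Prod.mk_right_injective τ).encard_image, Set.encard_coe_eq_coe_finsetCard,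
    Finset.card_range]

end FlaggedModel

/-- A cardinality as a value of a profile: finite numbers are cut off at `K`, and infinity is
`K + 1`. -/
noncomputable def cutoff (K : ℕ) (c : ℕ∞) : ℕ := if c = ⊤ then K + 1 else min K c.toNat

theorem cutoff_le (K : ℕ) (c : ℕ∞) : cutoff K c ≤ K + 1 := by
  unfold cutoff
  split_ifs <;> omega

theorem cutoff_eq_succ {K : ℕ} {c : ℕ∞} : cutoff K c = K + 1 ↔ c = ⊤ := by
  unfold cutoff
  split_ifs with h
  · simp [h]
  · simp only [h, iff_false]
    omega

theorem cutoff_mono (K : ℕ) : Monotone (cutoff K) := by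
  intro c c' h
  by_cases h' : c' = ⊤
  · exact (cutoff_le K c).trans (cutoff_eq_succ.2 h').ge
  · have h0 : c ≠ ⊤ := ne_top_of_le_ne_top h' h
    simp only [cutoff, h', h0, if_false]
    exact min_le_min_left _ (ENat.toNat_le_toNat h h')

theorem min_cutoff (K : ℕ) (c : ℕ∞) : ((min K (cutoff K c) : ℕ) : ℕ∞) = min (K : ℕ∞) c := by
  induction c with
  | top => simp [cutoff]
  | coe n => rcases le_total K n with h | h <;> simp [cutoff, h]

theorem cutoff_natCast {K n : ℕ} (h : n ≤ K) : cutoff K n = n := by simp [cutoff, h]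

theorem cutoff_le_iff {K n : ℕ} (h : n < K) {c : ℕ∞} : cutoff K c ≤ n ↔ c ≤ n := by
  induction c with
  | top => simp [cutoff]; omega
  | coe m => simp [cutoff]; omega

theorem cutoff_le_self_iff {K : ℕ} {c : ℕ∞} : cutoff K c ≤ K ↔ c ≠ ⊤ := by
  rw [ne_eq, ← cutoff_eq_succ (K := K)]
  have := cutoff_le K c
  omega

namespace Model
variable {A : Type u}

/-- The number of elements of each type, cut off at `K`, with infinity kept apart. -/
noncomputable def profile (D : Model.{u, v} A) (K : ℕ) (τ : Set A) : ℕ := cutoff K (D.flag.count τ)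

theorem flag_count (D : Model.{u, v} A) (τ : Set A) :
    D.flag.count τ = {d | D.ty d = τ}.encard := by
  change Set.encard {d : D.Dom | d ∈ Set.univ ∧ D.ty d = τ} = _
  simp

theorem similar_profile (D : Model.{u, v} A) (N : ℕ) :
    FlaggedModel.Similar .FOEInf N D.flag (FlaggedModel.ofProfile (N + 1) (D.profile (N + 1))) := by
  have hc : ∀ τ, (FlaggedModel.ofProfile (N + 1) (D.profile (N + 1))).count τ =
      min ((N + 1 : ℕ) : ℕ∞) (D.flag.count τ) := fun τ => by
    rw [FlaggedModel.count_ofProfile, profile, min_cutoff]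
  refine ⟨fun τ => ?_, fun _ τ => ?_, fun _ d _ d' _ h => ?_⟩
  · rw [hc, min_eq_zero]
    simp
  · rw [hc, ← min_assoc, min_self]
  · change Set.Infinite _ ↔ cutoff _ (D.flag.count d'.1) = _
    rw [cutoff_eq_succ, flag_count, ← show D.ty d = d'.1 from h, Set.encard_eq_top_iff]

/-- The truth of a sentence in a model is determined by its profile. -/
theorem models_iff_profile [Encodable A] [Finite A] (D : Model.{u, v} A) {N : ℕ} {φ : Formula A}
    (hφ : φ.code ≤ N) (hs : φ.IsSentence) :
    D.Models φ ↔ (FlaggedModel.ofProfile (N + 1) (D.profile (N + 1))).Holds N φ := by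
  rw [← D.flag_holds hφ hs, (D.similar_profile N).holds_iff φ.inLang_foeInf hφ]

theorem encard_subtype {D : Type v} (S : Set D) (p : D → Prop) :
    {s : S | p s.1}.encard = {d | d ∈ S ∧ p d}.encard := by
  rw [← Subtype.val_injective.encard_image]
  congr 1
  ext d
  constructor
  · rintro ⟨s, hs, rfl⟩
    exact ⟨s.2, hs⟩
  · rintro ⟨hd, h⟩
    exact ⟨⟨d, hd⟩, h, rfl⟩

/-- The submodel with domain `S`. -/
def restrict (D : Model.{u, v} A) (S : Set D.Dom) : Model.{u, v} A where
  Dom := S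
  val a := {s | s.1 ∈ D.val a}

theorem count_restrict (D : Model.{u, v} A) (S : Set D.Dom) (τ : Set A) :
    (D.restrict S).flag.count τ = {d | d ∈ S ∧ D.ty d = τ}.encard := by
  rw [flag_count]
  exact encard_subtype S fun d => D.ty d = τ

theorem eq_restrict (D : Model.{u, v} A) (S : Set D.Dom) (W : A → Set S)
    (h : IsHom (Model.mk S W) D Subtype.val) : Model.mk S W = D.restrict S := by
  have : W = fun a => {s : S | s.1 ∈ D.val a} := funext fun a => Set.ext fun s => h a s
  subst this
  rfl

theorem preserved_iff_restrict {φ : Formula A} : PreservedUnderSubmodels.{u, v} φ ↔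
    ∀ (D : Model.{u, v} A) (S : Set D.Dom), D.Models φ → (D.restrict S).Models φ := by
  refine ⟨fun h D S hD => h D S _ (fun a d => Iff.rfl) hD, fun h D S W hW hD => ?_⟩
  rw [eq_restrict D S W hW]
  exact h D S hD

theorem profile_restrict_le (D : Model.{u, v} A) (S : Set D.Dom) (K : ℕ) :
    (D.restrict S).profile K ≤ D.profile K := by
  refine fun τ => cutoff_mono K ?_
  rw [count_restrict, flag_count]
  exact Set.encard_le_encard fun d hd => hd.2

/-- The model in which each type is realized countably infinitely often. -/
noncomputable def universal (A : Type u) [Finite A] : Model.{u, v} A where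
  Dom := ULift.{v} (Fin (Nat.card (Set A)) × ℕ)
  val a := {d | a ∈ (Finite.equivFin (Set A)).symm d.down.1}

/-- The elements of the universal model that make up a submodel with profile `v`. -/
def profileSet [Finite A] (K : ℕ) (v : Set A → ℕ) : Set (universal.{u, v} A).Dom :=
  {d | d.down.2 < v ((universal A).ty d) ∨ v ((universal A).ty d) = K + 1}

theorem cutoff_encard_profileSet [Finite A] {K : ℕ} {v : Set A → ℕ} {τ : Set A}
    (hv : v τ ≤ K + 1) :
    cutoff K {d | d ∈ profileSet K v ∧ (universal.{u, v} A).ty d = τ}.encard = v τ := by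
  have hinj : Set.InjOn (fun d : (universal.{u, v} A).Dom => d.down.2)
      {d | d ∈ profileSet K v ∧ (universal A).ty d = τ} := by
    rintro ⟨i, m⟩ ⟨-, h1⟩ ⟨j, n⟩ ⟨-, h2⟩ (rfl : m = n)
    have : (Finite.equivFin (Set A)).symm i = (Finite.equivFin (Set A)).symm j := h1.trans h2.symm
    rw [(Equiv.injective _) this]
  have himg : (fun d : (universal.{u, v} A).Dom => d.down.2) ''
      {d | d ∈ profileSet K v ∧ (universal A).ty d = τ} = {i | i < v τ ∨ v τ = K + 1} := by
    ext i
    constructor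
    · rintro ⟨d, ⟨h1, rfl⟩, rfl⟩
      exact h1
    · intro hi
      have hτ : (universal A).ty ⟨(Finite.equivFin (Set A) τ, i)⟩ = τ :=
        (Finite.equivFin (Set A)).symm_apply_apply τ
      refine ⟨⟨(Finite.equivFin (Set A) τ, i)⟩, ⟨?_, hτ⟩, rfl⟩
      change _ < _ ∨ _ = _
      rw [hτ]
      exact hi
  rw [← hinj.encard_image, himg]
  rcases hv.lt_or_eq with h | h
  · have : {i | i < v τ ∨ v τ = K + 1} = (Finset.range (v τ) : Set ℕ) := by
      ext i
      simp [h.ne]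
    rw [this, Set.encard_coe_eq_coe_finsetCard, Finset.card_range, cutoff_natCast (by omega)]
  · simp only [h, or_true]
    rw [cutoff_eq_succ]
    simp

/-- Every function with values at most `K + 1` is a profile. -/
theorem profile_restrict_universal [Finite A] {K : ℕ} {v : Set A → ℕ} (hv : ∀ τ, v τ ≤ K + 1) :
    ((universal.{u, v} A).restrict (profileSet K v)).profile K = v := by
  funext τ
  rw [profile, count_restrict, cutoff_encard_profileSet (hv τ)]

/-- Preservation in terms of profiles: truth is downward closed. -/
theorem preserved_iff_profile [Encodable A] [Finite A] {N : ℕ} {φ : Formula A}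
    (hφ : φ.code ≤ N) (hs : φ.IsSentence) :
    PreservedUnderSubmodels.{u, v} φ ↔ ∀ v w : Set A → ℕ, (∀ τ, v τ ≤ N + 2) → w ≤ v →
      (FlaggedModel.ofProfile (N + 1) v).Holds N φ →
      (FlaggedModel.ofProfile (N + 1) w).Holds N φ := by
  rw [preserved_iff_restrict]
  constructor
  · intro h v w hv hwv hφv
    set D := (universal.{u, v} A).restrict (profileSet (N + 1) v) with hD
    rw [← profile_restrict_universal.{u, v} hv, ← models_iff_profile _ hφ hs] at hφv
    have h' := h D {d | d.1 ∈ profileSet (N + 1) w} hφv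
    rw [models_iff_profile _ hφ hs] at h'
    convert h' using 2
    funext τ
    rw [profile, count_restrict, ← cutoff_encard_profileSet.{u, v} ((hwv τ).trans (hv τ))]
    refine congrArg _ (Eq.trans ?_ (encard_subtype (profileSet (N + 1) v) fun d =>
      d ∈ profileSet (N + 1) w ∧ (universal A).ty d = τ).symm)
    congr 1
    ext d
    refine (and_iff_right_of_imp fun ⟨h1, _⟩ => ?_).symm
    have h3 : w ((universal A).ty d) ≤ v ((universal A).ty d) := hwv _
    have h4 := hv ((universal A).ty d)
    change _ < _ ∨ _ = _ at h1
    change _ < _ ∨ _ = _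
    omega
  · intro h D S hD
    rw [models_iff_profile _ hφ hs] at hD ⊢
    exact h _ _ (fun τ => cutoff_le _ _) (D.profile_restrict_le S _) hD

/-- Equivalence in terms of profiles. -/
theorem equivalent_iff_profile [Encodable A] [Finite A] {N : ℕ} {φ ψ : Formula A}
    (hφ : φ.code ≤ N) (hs : φ.IsSentence)
    (hψ : ψ.code ≤ N) (hs' : ψ.IsSentence) :
    Equivalent.{u, v} φ ψ ↔ ∀ v : Set A → ℕ, (∀ τ, v τ ≤ N + 2) →
      ((FlaggedModel.ofProfile (N + 1) v).Holds N φ ↔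
      (FlaggedModel.ofProfile (N + 1) v).Holds N ψ) := by
  constructor
  · intro h v hv
    rw [← profile_restrict_universal.{u, v} hv, ← models_iff_profile _ hφ hs,
      ← models_iff_profile _ hψ hs']
    exact h _
  · intro h D
    rw [models_iff_profile _ hφ hs, models_iff_profile _ hψ hs']
    exact h _ fun τ => cutoff_le _ _

end Model
end MonadicPred

namespace MonadicPred
open Function

/-! ### Universal sentences are preserved -/

namespace Formula
variable {A : Type u}

theorem InUniv.sat_restrict {L : Logic} {φ : Formula A} (h : φ.InUniv L) (D : Model.{u, v} A)
    (S : Set D.Dom) (g : ℕ → S) (hφ : φ.Sat D (Subtype.val ∘ g)) : φ.Sat (D.restrict S) g := by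
  induction φ generalizing g with
  | top | pos | neg => exact hφ
  | bot => exact hφ
  | eq x y => exact Subtype.ext hφ
  | ne x y => exact fun he => hφ (congrArg Subtype.val he)
  | or φ ψ ih₁ ih₂ => exact hφ.imp (ih₁ h.1 g) (ih₂ h.2 g)
  | and φ ψ ih₁ ih₂ => exact hφ.imp (ih₁ h.1 g) (ih₂ h.2 g)
  | ex x φ ih | exInf x φ ih => exact h.elim
  | all x φ ih =>
    intro d
    have e := comp_update (Subtype.val : S → D.Dom) g x d
    exact ih h _ ((congrArg (fun g' => φ.Sat D g') e).mpr (hφ d.1))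
  | allInf x φ ih =>
    refine (Set.Finite.preimage Subtype.val_injective.injOn hφ).subset ?_
    intro d hd hd'
    have e := comp_update (Subtype.val : S → D.Dom) g x d
    exact hd (ih h.2 _ ((congrArg (fun g' => φ.Sat D g') e).mpr hd'))

theorem InUniv.trueInEmpty {L : Logic} {φ : Formula A} (h : φ.InUniv L) (hs : φ.IsSentence)
    {D : Model.{u, v} A} {g : ℕ → D.Dom} (hφ : φ.Sat D g) : φ.TrueInEmpty := by
  unfold IsSentence at hs
  induction φ with
  | top | all | allInf => trivial
  | bot => exact hφ
  | pos | neg | eq | ne => simp [freeVars] at hs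
  | or φ ψ ih₁ ih₂ =>
    rw [freeVars, Finset.union_eq_empty] at hs
    exact hφ.imp (ih₁ h.1 hs.1) (ih₂ h.2 hs.2)
  | and φ ψ ih₁ ih₂ =>
    rw [freeVars, Finset.union_eq_empty] at hs
    exact hφ.imp (ih₁ h.1 hs.1) (ih₂ h.2 hs.2)
  | ex x φ ih | exInf x φ ih => exact h.elim

theorem InUniv.preserved {L : Logic} {φ : Formula A} (h : φ.InUniv L) (hs : φ.IsSentence) :
    PreservedUnderSubmodels.{u, v} φ := by
  rw [Model.preserved_iff_restrict]
  rintro D S (⟨hD, hφ⟩ | ⟨⟨d⟩, hφ⟩)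
  · exact .inl ⟨⟨fun s => hD.false s.1⟩, hφ⟩
  · rcases isEmpty_or_nonempty S with hS | hS
    · exact .inl ⟨hS, h.trueInEmpty hs (hφ fun _ => d)⟩
    · exact .inr ⟨hS, fun g => h.sat_restrict D S g (hφ _)⟩

/-! ### Building universal sentences -/

/-- The disjunction of a list of formulas. -/
def bigOr (l : List (Formula A)) : Formula A := l.foldr or bot

/-- The conjunction of a list of formulas. -/
def bigAnd (l : List (Formula A)) : Formula A := l.foldr and top

theorem inUniv_bigOr {L : Logic} {l : List (Formula A)} (h : ∀ φ ∈ l, φ.InUniv L) :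
    (bigOr l).InUniv L := by
  induction l with
  | nil => trivial
  | cons φ l ih =>
    exact ⟨h φ (by simp), ih fun ψ hψ => h ψ (by simp [hψ])⟩

theorem inUniv_bigAnd {L : Logic} {l : List (Formula A)} (h : ∀ φ ∈ l, φ.InUniv L) :
    (bigAnd l).InUniv L := by
  induction l with
  | nil => trivial
  | cons φ l ih =>
    exact ⟨h φ (by simp), ih fun ψ hψ => h ψ (by simp [hψ])⟩

theorem mem_freeVars_bigOr {l : List (Formula A)} {x : ℕ} :
    x ∈ (bigOr l).freeVars ↔ ∃ φ ∈ l, x ∈ φ.freeVars := by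
  induction l with
  | nil => simp [bigOr, freeVars]
  | cons φ l ih => simpa [bigOr, freeVars] using or_congr Iff.rfl ih

theorem mem_freeVars_bigAnd {l : List (Formula A)} {x : ℕ} :
    x ∈ (bigAnd l).freeVars ↔ ∃ φ ∈ l, x ∈ φ.freeVars := by
  induction l with
  | nil => simp [bigAnd, freeVars]
  | cons φ l ih => simpa [bigAnd, freeVars] using or_congr Iff.rfl ih

theorem isSentence_bigOr {l : List (Formula A)} (h : ∀ φ ∈ l, φ.IsSentence) :
    (bigOr l).IsSentence := by
  refine Finset.eq_empty_of_forall_notMem fun x hx => ?_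
  obtain ⟨φ, hφ, hx⟩ := mem_freeVars_bigOr.1 hx
  rw [show φ.freeVars = ∅ from h φ hφ] at hx
  simp at hx

theorem isSentence_bigAnd {l : List (Formula A)} (h : ∀ φ ∈ l, φ.IsSentence) :
    (bigAnd l).IsSentence := by
  refine Finset.eq_empty_of_forall_notMem fun x hx => ?_
  obtain ⟨φ, hφ, hx⟩ := mem_freeVars_bigAnd.1 hx
  rw [show φ.freeVars = ∅ from h φ hφ] at hx
  simp at hx

theorem sat_bigOr {D : Model.{u, v} A} {g : ℕ → D.Dom} {l : List (Formula A)} :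
    (bigOr l).Sat D g ↔ ∃ φ ∈ l, φ.Sat D g := by
  induction l with
  | nil => simp [bigOr, Sat]
  | cons φ l ih => simpa [bigOr, Sat] using or_congr Iff.rfl ih

theorem IsSentence.models_iff {φ : Formula A} (hs : φ.IsSentence) {D : Model.{u, v} A}
    (g : ℕ → D.Dom) : D.Models φ ↔ φ.Sat D g := by
  constructor
  · rintro (⟨h, -⟩ | ⟨-, h⟩)
    · exact (h.false (g 0)).elim
    · exact h g
  · intro h
    exact .inr ⟨⟨g 0⟩, fun g' => (sat_congr D (by simp [show φ.freeVars = ∅ from hs])).1 h⟩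

theorem models_of_isEmpty {D : Model.{u, v} A} [h : IsEmpty D.Dom] {φ : Formula A} :
    D.Models φ ↔ φ.TrueInEmpty := by
  simp [Model.Models, h]

theorem models_bigOr {D : Model.{u, v} A} {l : List (Formula A)} (h : ∀ φ ∈ l, φ.IsSentence) :
    D.Models (bigOr l) ↔ ∃ φ ∈ l, D.Models φ := by
  rcases isEmpty_or_nonempty D.Dom with hD | ⟨⟨d⟩⟩
  · simp only [models_of_isEmpty]
    clear h
    induction l with
    | nil => simp [bigOr, TrueInEmpty]
    | cons φ l ih => simpa [bigOr, TrueInEmpty] using or_congr Iff.rfl ih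
  · rw [(isSentence_bigOr h).models_iff fun _ => d, sat_bigOr]
    exact exists_congr fun φ => and_congr_right fun hφ => ((h φ hφ).models_iff _).symm

theorem models_bigAnd {D : Model.{u, v} A} {l : List (Formula A)} (h : ∀ φ ∈ l, φ.IsSentence) :
    D.Models (bigAnd l) ↔ ∀ φ ∈ l, D.Models φ := by
  rcases isEmpty_or_nonempty D.Dom with hD | ⟨⟨d⟩⟩
  · simp only [models_of_isEmpty]
    clear h
    induction l with
    | nil => simp [bigAnd, TrueInEmpty]
    | cons φ l ih => simpa [bigAnd, TrueInEmpty] using and_congr Iff.rfl ih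
  · rw [(isSentence_bigAnd h).models_iff fun _ => d]
    have : ∀ g : ℕ → D.Dom, (bigAnd l).Sat D g ↔ ∀ φ ∈ l, φ.Sat D g := by
      intro g
      clear h
      induction l with
      | nil => simp [bigAnd, Sat]
      | cons φ l ih => simpa [bigAnd, Sat] using and_congr Iff.rfl ih
    rw [this]
    exact forall_congr' fun φ => forall_congr' fun hφ => ((h φ hφ).models_iff _).symm

/-- Universal quantification over all variables below `m`. -/
def allBelow : ℕ → Formula A → Formula A
  | 0, φ => φ
  | m + 1, φ => allBelow m (all m φ)

theorem inUniv_allBelow {L : Logic} {m : ℕ} {φ : Formula A} (h : φ.InUniv L) :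
    (allBelow m φ).InUniv L := by
  induction m generalizing φ with
  | zero => exact h
  | succ m ih => exact ih (φ := all m φ) h

theorem mem_freeVars_allBelow {m : ℕ} {φ : Formula A} {x : ℕ}
    (h : x ∈ (allBelow m φ).freeVars) : x ∈ φ.freeVars ∧ m ≤ x := by
  induction m generalizing φ with
  | zero => exact ⟨h, x.zero_le⟩
  | succ m ih =>
    obtain ⟨h1, h2⟩ := ih h
    obtain ⟨h3, h4⟩ := Finset.mem_erase.1 h1
    exact ⟨h4, lt_of_le_of_ne h2 (Ne.symm h3)⟩

theorem trueInEmpty_allBelow {m : ℕ} {φ : Formula A} (h : φ.TrueInEmpty) :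
    (allBelow m φ).TrueInEmpty := by
  induction m generalizing φ with
  | zero => exact h
  | succ m ih => exact ih (φ := all m φ) trivial

theorem sat_allBelow {D : Model.{u, v} A} {m : ℕ} {φ : Formula A} {g : ℕ → D.Dom} :
    (allBelow m φ).Sat D g ↔ ∀ h : ℕ → D.Dom, (∀ x, m ≤ x → h x = g x) → φ.Sat D h := by
  induction m generalizing φ with
  | zero =>
    refine ⟨fun hφ h hh => ?_, fun hφ => hφ g fun _ _ => rfl⟩
    rwa [show h = g from funext fun x => hh x x.zero_le]
  | succ m ih =>
    rw [allBelow, ih]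
    constructor
    · intro hφ h hh
      have := hφ (update h m (g m)) (fun x hx => ?_) (h m)
      · simpa using this
      · by_cases hxm : x = m
        · subst hxm; simp
        · simpa [hxm] using hh x (by omega)
    · intro hφ h hh d
      refine hφ _ fun x hx => ?_
      rw [update_of_ne (by omega), hh x (by omega)]

variable [Finite A]

open Classical in
/-- The formula saying that the type of `x` is not `τ`. -/
noncomputable def notType (τ : Set A) (x : ℕ) : Formula A :=
  letI := Fintype.ofFinite A
  bigOr (Finset.univ.toList.map fun a => if a ∈ τ then neg a x else pos a x)

theorem inUniv_notType (L : Logic) (τ : Set A) (x : ℕ) : (notType τ x).InUniv L := by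
  refine inUniv_bigOr fun φ hφ => ?_
  obtain ⟨a, -, rfl⟩ := List.mem_map.1 hφ
  split_ifs <;> trivial

theorem mem_freeVars_notType {τ : Set A} {x y : ℕ} (h : y ∈ (notType τ x).freeVars) : y = x := by
  obtain ⟨φ, hφ, hy⟩ := mem_freeVars_bigOr.1 h
  obtain ⟨a, -, rfl⟩ := List.mem_map.1 hφ
  split_ifs at hy <;> simpa [freeVars] using hy

theorem sat_notType {D : Model.{u, v} A} {g : ℕ → D.Dom} {τ : Set A} {x : ℕ} :
    (notType τ x).Sat D g ↔ D.ty (g x) ≠ τ := by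
  rw [notType, sat_bigOr, Ne, Set.ext_iff, not_forall]
  simp only [List.mem_map, Finset.mem_toList, Finset.mem_univ, true_and, exists_exists_eq_and]
  refine exists_congr fun a => ?_
  split_ifs with h
  · simp [h, Sat, Model.ty]
  · simp [h, Sat, Model.ty]

/-- The sentence saying that at most `j` elements have type `τ`.  For `j = 0` it does not contain
equality. -/
noncomputable def atMost (τ : Set A) (j : ℕ) : Formula A :=
  allBelow (j + 1) (or (bigOr ((List.range (j + 1)).map (notType τ)))
    (bigOr ((List.range (j + 1)).flatMap fun i => (List.range i).map fun i' => eq i i')))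

theorem isSentence_atMost (τ : Set A) (j : ℕ) : (atMost τ j).IsSentence := by
  refine Finset.eq_empty_of_forall_notMem fun x hx => ?_
  obtain ⟨hx, hj⟩ := mem_freeVars_allBelow hx
  rcases Finset.mem_union.1 hx with hx | hx
  · obtain ⟨φ, hφ, hx⟩ := mem_freeVars_bigOr.1 hx
    obtain ⟨i, hi, rfl⟩ := List.mem_map.1 hφ
    have := mem_freeVars_notType hx
    have := List.mem_range.1 hi
    omega
  · obtain ⟨φ, hφ, hx⟩ := mem_freeVars_bigOr.1 hx
    obtain ⟨i, hi, hφ⟩ := List.mem_flatMap.1 hφ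
    obtain ⟨i', hi', rfl⟩ := List.mem_map.1 hφ
    have := List.mem_range.1 hi
    have := List.mem_range.1 hi'
    simp only [freeVars, Finset.mem_insert, Finset.mem_singleton] at hx
    omega

theorem inUniv_atMost {L : Logic} (τ : Set A) {j : ℕ} (h : j = 0 ∨ L.HasEq) :
    (atMost τ j).InUniv L := by
  refine inUniv_allBelow ⟨inUniv_bigOr fun φ hφ => ?_, inUniv_bigOr fun φ hφ => ?_⟩
  · obtain ⟨i, hi, rfl⟩ := List.mem_map.1 hφ
    exact inUniv_notType L τ i
  · obtain ⟨i, hi, hφ⟩ := List.mem_flatMap.1 hφ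
    obtain ⟨i', hi', rfl⟩ := List.mem_map.1 hφ
    have := List.mem_range.1 hi
    have := List.mem_range.1 hi'
    exact h.resolve_left (by omega)

theorem models_atMost {D : Model.{u, v} A} {τ : Set A} {j : ℕ} :
    D.Models (atMost τ j) ↔ D.flag.count τ ≤ j := by
  rw [Model.flag_count]
  rcases isEmpty_or_nonempty D.Dom with hD | ⟨⟨d₀⟩⟩
  · have h0 : {d | D.ty d = τ} = ∅ := Set.eq_empty_of_isEmpty _
    rw [models_of_isEmpty, h0, Set.encard_empty]
    exact iff_of_true (trueInEmpty_allBelow (φ := all j _) trivial) zero_le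
  rw [(isSentence_atMost τ j).models_iff fun _ => d₀, atMost, sat_allBelow]
  simp only [Sat, sat_bigOr, List.mem_map, List.mem_flatMap, List.mem_range]
  constructor
  · intro H
    by_contra! hlt
    obtain ⟨t, hts, ht⟩ := Set.exists_subset_encard_eq (Order.add_one_le_of_lt hlt)
    have htf : t.Finite := Set.finite_of_encard_eq_coe (k := j + 1) (by simpa using ht)
    have hcard : htf.toFinset.card = j + 1 := by
      rw [htf.encard_eq_coe_toFinset_card] at ht
      exact_mod_cast ht
    let e := htf.toFinset.equivFinOfCardEq hcard
    have hval : ∀ i (hi : i < j + 1), (if hi : i < j + 1 then (e.symm ⟨i, hi⟩).1 else d₀) =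
        (e.symm ⟨i, hi⟩).1 := fun i hi => dif_pos hi
    rcases H (fun i => if hi : i < j + 1 then (e.symm ⟨i, hi⟩).1 else d₀)
        (fun x hx => dif_neg (by omega)) with ⟨_, ⟨i, hi, rfl⟩, h⟩ | ⟨_, ⟨i, hi, i', hi', rfl⟩, h⟩
    · rw [sat_notType, hval i hi] at h
      exact h (hts (htf.mem_toFinset.1 (e.symm ⟨i, hi⟩).2))
    · simp only [Sat] at h
      rw [hval i hi, hval i' (by omega)] at h
      have := e.symm.injective (Subtype.ext h)
      rw [Fin.mk.injEq] at this
      omega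
  · intro hle h _
    by_contra! hcon
    obtain ⟨h1, h2⟩ := hcon
    have h1' : ∀ i < j + 1, D.ty (h i) = τ := fun i hi => by
      simpa [sat_notType] using h1 _ ⟨i, hi, rfl⟩
    have h2' : ∀ i < j + 1, ∀ i' < i, h i ≠ h i' := fun i hi i' hi' => h2 _ ⟨i, hi, i', hi', rfl⟩
    have hinj : Set.InjOn h (Finset.range (j + 1) : Set ℕ) := by
      intro i hi i' hi' he
      simp only [Finset.coe_range, Set.mem_Iio] at hi hi'
      rcases lt_trichotomy i i' with hlt | heq | hlt
      · exact absurd he.symm (h2' i' hi' i hlt)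
      · exact heq
      · exact absurd he (h2' i hi i' hlt)
    have h3 : h '' (Finset.range (j + 1) : Set ℕ) ⊆ {d | D.ty d = τ} := by
      rintro _ ⟨i, hi, rfl⟩
      exact h1' i (by simpa using hi)
    have h4 := (Set.encard_le_encard h3).trans hle
    rw [hinj.encard_image, Set.encard_coe_eq_coe_finsetCard, Finset.card_range] at h4
    have : j + 1 ≤ j := by exact_mod_cast h4
    omega

theorem models_allInf_notType {D : Model.{u, v} A} {τ : Set A} :
    D.Models (allInf 0 (notType τ 0)) ↔ D.flag.count τ ≠ ⊤ := by
  rw [Model.flag_count, Ne, Set.encard_eq_top_iff, Set.not_infinite]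
  rcases isEmpty_or_nonempty D.Dom with hD | ⟨⟨d₀⟩⟩
  · rw [models_of_isEmpty]
    exact iff_of_true trivial (Set.toFinite _)
  · have hs : (allInf 0 (notType τ 0)).IsSentence := by
      refine Finset.eq_empty_of_forall_notMem fun x hx => ?_
      obtain ⟨h1, h2⟩ := Finset.mem_erase.1 hx
      exact h1 (mem_freeVars_notType h2)
    rw [hs.models_iff fun _ => d₀]
    simp [Sat, sat_notType]

end Formula

/-- The largest value of a profile, with threshold `K`, that sentences of `L` with Gödel number
below `K` do not tell apart from `j`: without equality positive numbers look alike, and without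
`∃^∞` large finite numbers look infinite. -/
def Logic.close (K : ℕ) : Logic → ℕ → ℕ
  | .M, j => if j = 0 then 0 else K + 1
  | .FOE, j => if j < K then j else K + 1
  | .FOEInf, j => j

theorem Logic.le_close (L : Logic) {K j : ℕ} (h : j ≤ K + 1) : j ≤ L.close K j := by
  cases L <;> simp only [Logic.close] <;> (try split_ifs) <;> omega

theorem Logic.close_le (L : Logic) {K j : ℕ} (h : j ≤ K + 1) : L.close K j ≤ K + 1 := by
  cases L <;> simp only [Logic.close] <;> (try split_ifs) <;> omega

/-- Passing to the closure of a profile does not affect the truth of sentences of `L`. -/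
theorem Logic.similar_close {A : Type u} (L : Logic) (N : ℕ) (v : Set A → ℕ) :
    FlaggedModel.Similar L N (FlaggedModel.ofProfile (N + 1) v)
      (FlaggedModel.ofProfile (N + 1) fun τ => L.close (N + 1) (v τ)) := by
  refine ⟨fun τ => ?_, fun hL τ => ?_, fun hL d hd d' hd' h => ?_⟩
  · rw [FlaggedModel.count_ofProfile, FlaggedModel.count_ofProfile]
    rw [Nat.cast_eq_zero, Nat.cast_eq_zero]
    cases L <;> simp only [Logic.close] <;> (try split_ifs) <;> omega
  · rw [FlaggedModel.count_ofProfile, FlaggedModel.count_ofProfile]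
    have hmin : min (N + 1) (v τ) = min (N + 1) (L.close (N + 1) (v τ)) := by
      cases L <;> simp only [Logic.close] <;> (try split_ifs) <;> first | omega | exact hL.elim
    rw [hmin]
  · cases L
    · exact hL.elim
    · exact hL.elim
    · change v d.1 = _ ↔ v d'.1 = _
      rw [show d.1 = d'.1 from h]

namespace Formula
variable {A : Type u} [Finite A]

/-- The universal sentence of `L` saying that the number of elements of type `τ` is at most the
closure of `j`. -/
noncomputable def countLe (L : Logic) (K : ℕ) (τ : Set A) (j : ℕ) : Formula A :=
  if L.close K j = K + 1 then top else
    if L.close K j = K then allInf 0 (notType τ 0) else atMost τ (L.close K j)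

theorem isSentence_countLe (L : Logic) (K : ℕ) (τ : Set A) (j : ℕ) :
    (countLe L K τ j).IsSentence := by
  unfold countLe
  split_ifs
  · rfl
  · refine Finset.eq_empty_of_forall_notMem fun x hx => ?_
    obtain ⟨h1, h2⟩ := Finset.mem_erase.1 hx
    exact h1 (mem_freeVars_notType h2)
  · exact isSentence_atMost τ _

theorem inUniv_countLe (L : Logic) {K : ℕ} (hK : 0 < K) (τ : Set A) (j : ℕ) :
    (countLe L K τ j).InUniv L := by
  unfold countLe
  split_ifs with h1 h2
  · trivial
  · refine ⟨?_, inUniv_notType L τ 0⟩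
    cases L <;> simp only [Logic.close] at h1 h2
    · split_ifs at h1 h2 <;> omega
    · split_ifs at h1 h2 <;> omega
    · trivial
  · refine inUniv_atMost τ ?_
    cases L
    · left
      simp only [Logic.close] at h1 ⊢
      split_ifs at h1 ⊢ <;> simp at h1 ⊢
    · exact .inr trivial
    · exact .inr trivial

theorem models_countLe (L : Logic) {K : ℕ} (τ : Set A) {j : ℕ} (hj : j ≤ K + 1)
    {D : Model.{u, v} A} : D.Models (countLe L K τ j) ↔ D.profile K τ ≤ L.close K j := by
  have hle := L.close_le hj
  unfold countLe Model.profile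
  split_ifs with h1 h2
  · rw [h1]
    refine iff_of_true ?_ (cutoff_le _ _)
    rcases isEmpty_or_nonempty D.Dom with hD | hD
    · exact .inl ⟨hD, trivial⟩
    · exact .inr ⟨hD, fun _ => trivial⟩
  · rw [h2, models_allInf_notType, cutoff_le_self_iff]
  · rw [models_atMost, cutoff_le_iff (by omega)]

/-- The disjunction, over the profiles `v` at which `φ` holds, of the sentences saying that the
profile of the model is below the closure of `v`, is a universal equivalent of `φ`. -/
theorem exists_inUniv_of_preserved [Encodable A] {L : Logic} {φ : Formula A} (hL : φ.InLang L)
    (hs : φ.IsSentence) (h : PreservedUnderSubmodels.{u, v} φ) :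
    ∃ ψ : Formula A, ψ.InUniv L ∧ ψ.IsSentence ∧ Equivalent.{u, v} φ ψ := by
  set N := φ.code with hN
  have hfin : {v : Set A → ℕ | (∀ τ, v τ ≤ N + 2) ∧
      (FlaggedModel.ofProfile (N + 1) v).Holds N φ}.Finite :=
    (Set.Finite.pi' fun _ => Set.finite_Iic (N + 2)).subset fun v hv => hv.1
  let _ := Fintype.ofFinite (Set A)
  set conj : (Set A → ℕ) → Formula A := fun v =>
    bigAnd (Finset.univ.toList.map fun τ => countLe L (N + 1) τ (v τ)) with hconj
  have hconjs : ∀ v, (conj v).IsSentence := by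
    refine fun v => isSentence_bigAnd fun ψ hψ => ?_
    obtain ⟨τ, -, rfl⟩ := List.mem_map.1 hψ
    exact isSentence_countLe _ _ _ _
  have hs' : ∀ ψ ∈ hfin.toFinset.toList.map conj, ψ.IsSentence := by
    intro ψ hψ
    obtain ⟨v, -, rfl⟩ := List.mem_map.1 hψ
    exact hconjs v
  refine ⟨bigOr (hfin.toFinset.toList.map conj), inUniv_bigOr fun ψ hψ => ?_,
    isSentence_bigOr hs', fun D => ?_⟩
  · obtain ⟨v, -, rfl⟩ := List.mem_map.1 hψ
    refine inUniv_bigAnd fun ψ hψ => ?_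
    obtain ⟨τ, -, rfl⟩ := List.mem_map.1 hψ
    exact inUniv_countLe L N.succ_pos τ _
  have hmod : D.Models (bigOr (hfin.toFinset.toList.map conj)) ↔ ∃ v : Set A → ℕ,
      ((∀ τ, v τ ≤ N + 2) ∧ (FlaggedModel.ofProfile (N + 1) v).Holds N φ) ∧
      ∀ τ, D.profile (N + 1) τ ≤ L.close (N + 1) (v τ) := by
    rw [models_bigOr hs']
    simp only [List.mem_map, Finset.mem_toList, Set.Finite.mem_toFinset, exists_exists_and_eq_and]
    refine exists_congr fun v => and_congr_right fun hv => ?_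
    rw [hconj, models_bigAnd]
    · simp only [List.mem_map, Finset.mem_toList, Finset.mem_univ, true_and,
        forall_exists_index, forall_apply_eq_imp_iff]
      exact forall_congr' fun τ => models_countLe L τ (hv.1 τ)
    · intro ψ hψ
      obtain ⟨τ, -, rfl⟩ := List.mem_map.1 hψ
      exact isSentence_countLe _ _ _ _
  rw [hmod, D.models_iff_profile hN.ge hs]
  constructor
  · intro hD
    exact ⟨_, ⟨fun τ => cutoff_le _ _, hD⟩, fun τ => L.le_close (cutoff_le _ _)⟩
  · rintro ⟨v, ⟨hv, hφ⟩, hD⟩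
    exact (Model.preserved_iff_profile hN.ge hs).1 h _ _
      (fun τ => L.close_le (hv τ)) hD ((L.similar_close N v).holds hL hN.ge hφ)

theorem preserved_iff_exists_inUniv [Encodable A] {L : Logic} {φ : Formula A} (hL : φ.InLang L)
    (hs : φ.IsSentence) : PreservedUnderSubmodels.{u, v} φ ↔
      ∃ ψ : Formula A, ψ.InUniv L ∧ ψ.IsSentence ∧ Equivalent.{u, v} φ ψ := by
  refine ⟨exists_inUniv_of_preserved hL hs, ?_⟩
  rintro ⟨ψ, hψ, hψs, he⟩ D S W hW hD
  exact (he _).2 (hψ.preserved hψs D S W hW ((he D).1 hD))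

end Formula
end MonadicPred

/-! ### Primitive recursion on formulas -/

namespace MonadicPred
open Function

section Primrec

variable {α β σ : Type*} [Primcodable α] [Primcodable β] [Primcodable σ]

theorem primrecPred_const (p : Prop) : PrimrecPred fun _ : α => p := by
  classical
  exact ⟨fun _ => inferInstance, Primrec.const (decide p)⟩

theorem _root_.PrimrecPred.imp {p q : α → Prop} (hp : PrimrecPred p) (hq : PrimrecPred q) :
    PrimrecPred fun a => p a → q a :=
  (hp.not.or hq).of_eq fun _ => imp_iff_not_or.symm

theorem _root_.PrimrecPred.iff {p q : α → Prop} (hp : PrimrecPred p) (hq : PrimrecPred q) :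
    PrimrecPred fun a => p a ↔ q a :=
  ((hp.imp hq).and (hq.imp hp)).of_eq fun _ => iff_iff_implies_and_implies.symm

theorem primrecPred_exists_mem {f : α → List β} (hf : Primrec f) {p : α → β → Prop}
    (hp : PrimrecPred fun x : α × β => p x.1 x.2) : PrimrecPred fun a => ∃ b ∈ f a, p a b :=
  (PrimrecRel.exists_mem_list (R := fun b a => p a b)
    (hp.comp (Primrec.pair Primrec.snd Primrec.fst))).comp hf Primrec.id

theorem primrecPred_forall_mem {f : α → List β} (hf : Primrec f) {p : α → β → Prop}
    (hp : PrimrecPred fun x : α × β => p x.1 x.2) : PrimrecPred fun a => ∀ b ∈ f a, p a b :=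
  (PrimrecRel.forall_mem_list (R := fun b a => p a b)
    (hp.comp (Primrec.pair Primrec.snd Primrec.fst))).comp hf Primrec.id

theorem primrecPred_mem {f : α → List β} {b : α → β} (hf : Primrec f) (hb : Primrec b) :
    PrimrecPred fun a => b a ∈ f a :=
  (primrecPred_exists_mem hf (p := fun a b' => b' = b a)
    (Primrec.eq.comp Primrec.snd (hb.comp Primrec.fst))).of_eq fun a => by simp

/-- The lists of length `n` with entries from `L`. -/
def listsOf {β : Type*} (L : List β) : ℕ → List (List β)
  | 0 => [[]]
  | n + 1 => (listsOf L n).flatMap fun l => L.map fun b => b :: l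

theorem mem_listsOf {β : Type*} {L : List β} {n : ℕ} {l : List β} :
    l ∈ listsOf L n ↔ l.length = n ∧ ∀ b ∈ l, b ∈ L := by
  induction n generalizing l with
  | zero => simp +contextual [listsOf]
  | succ n ih =>
    simp only [listsOf, List.mem_flatMap, ih, List.mem_map]
    constructor
    · rintro ⟨l, ⟨rfl, h⟩, b, hb, rfl⟩
      simpa using ⟨hb, h⟩
    · rintro ⟨h1, h2⟩
      cases l with
      | nil => simp at h1
      | cons b l =>
        exact ⟨l, by simpa using ⟨by simpa using h1, fun c hc => h2 c (by simp [hc])⟩, b,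
          h2 b (by simp), rfl⟩

theorem primrec_listsOf : Primrec₂ (listsOf : List β → ℕ → List (List β)) := by
  refine (Primrec.nat_rec (f := fun _ : List β => [[]])
    (g := fun L (p : ℕ × List (List β)) => p.2.flatMap fun l => L.map fun b => b :: l)
    (Primrec.const _) ?_).of_eq fun p n => ?_
  · refine Primrec.list_flatMap (Primrec.snd.comp Primrec.snd) ?_
    refine Primrec.list_map (Primrec.fst.comp Primrec.fst) ?_
    exact Primrec.list_cons.comp Primrec.snd (Primrec.snd.comp Primrec.fst)
  · induction n with
    | zero => rfl
    | succ n ih => simp only [listsOf, ← ih]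

/-- A total primitive recursive relation has a computable choice function, by unbounded search. -/
theorem exists_computable_choice {R : α → β → Prop} (hR : PrimrecRel R) (h : ∀ a, ∃ b, R a b) :
    ∃ t : α → β, Computable t ∧ ∀ a, R a (t a) := by
  classical
  set f : α → ℕ → Option β := fun a n =>
    (Encodable.decode (α := β) n).bind fun b => Option.guard (fun b => R a b) b with hf
  have hfc : Computable₂ f := by
    refine Primrec.to_comp (Primrec.option_bind (Primrec.decode.comp Primrec.snd) ?_)
    exact Primrec.option_guard (p := fun (x : (α × ℕ) × β) b => R x.1.1 b)
      (hR.comp (Primrec.fst.comp (Primrec.fst.comp Primrec.fst)) Primrec.snd) Primrec.snd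
  have hdom : ∀ a, (Nat.rfindOpt (f a)).Dom := by
    intro a
    obtain ⟨b, hb⟩ := h a
    exact Nat.rfindOpt_dom.2 ⟨Encodable.encode b, b, by simp [hf, Option.guard, hb]⟩
  refine ⟨fun a => (Nat.rfindOpt (f a)).get (hdom a),
    (Partrec.rfindOpt hfc).of_eq_tot fun a => Part.get_mem _, fun a => ?_⟩
  obtain ⟨n, hn⟩ := Nat.rfindOpt_spec (Part.get_mem (hdom a))
  obtain ⟨b, -, hb⟩ := Option.bind_eq_some_iff.1 hn
  have := Option.guard_eq_some_iff.1 hb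
  simpa [← this.1] using this.2

end Primrec

namespace Formula
variable {A : Type u} [Primcodable A] {α σ : Type*} [Primcodable α] [Primcodable σ]

/-- Structural recursion on formulas with a primitive recursive step is primitive recursive.  The
step receives the three components of the Gödel number of the formula, and the values at the
subformulas whose Gödel numbers are its second and third component (and junk where these are not
subformulas). -/
theorem primrec_structural_rec {f : α → Formula A → σ} (d : σ)
    {G : (α × ℕ × ℕ × ℕ) × (σ × σ) → σ} (hG : Primrec G)
    (h : ∀ (a : α) (φ : Formula A) (r : ℕ → σ), (∀ ψ : Formula A, ψ.code < φ.code →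
      r ψ.code = f a ψ) → f a φ = G ((a, φ.code.unpair.1, φ.code.unpair.2.unpair.1,
        φ.code.unpair.2.unpair.2),
        (r φ.code.unpair.2.unpair.1, r φ.code.unpair.2.unpair.2))) : Primrec₂ f := by
  classical
  -- The function on Gödel numbers that strong recursion applies to; it is `d` off the formulas.
  set F : α → ℕ → σ := fun a n => if hn : ∃ φ : Formula A, φ.code = n then f a hn.choose else d
    with hF
  have hFc : ∀ a φ, F a (code φ) = f a φ := by
    intro a φ
    have hex : ∃ ψ : Formula A, ψ.code = φ.code := ⟨φ, rfl⟩
    rw [hF]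
    dsimp only
    rw [dif_pos hex, code_injective hex.choose_spec]
  have hlen : Primrec fun p : α × List σ => p.2.length := Primrec.list_length.comp Primrec.snd
  have hk := Primrec.fst.comp (Primrec.unpair.comp hlen)
  have hm := Primrec.snd.comp (Primrec.unpair.comp hlen)
  have hp := Primrec.fst.comp (Primrec.unpair.comp hm)
  have hq := Primrec.snd.comp (Primrec.unpair.comp hm)
  have hrec : Primrec₂ F := by
    refine Primrec.nat_strong_rec F (g := fun a l => some
      (if l.length ∈ Set.range (code : Formula A → ℕ) then
        G ((a, l.length.unpair.1, l.length.unpair.2.unpair.1, l.length.unpair.2.unpair.2),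
          (l.getD l.length.unpair.2.unpair.1 d, l.getD l.length.unpair.2.unpair.2 d)) else d))
      (Primrec.option_some.comp ?_) ?_
    · refine Primrec.ite (primrecPred_isCode.comp hlen) (hG.comp ?_) (Primrec.const d)
      exact Primrec.pair (Primrec.pair Primrec.fst (Primrec.pair hk (Primrec.pair hp hq)))
        (Primrec.pair ((Primrec.list_getD d).comp Primrec.snd hp)
          ((Primrec.list_getD d).comp Primrec.snd hq))
    · intro a n
      simp only [List.length_map, List.length_range, Option.some.injEq]
      split_ifs with hn
      · obtain ⟨φ, rfl⟩ := hn
        rw [hFc, h a φ fun m => ((List.range φ.code).map (F a)).getD m d]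
        intro ψ hψ
        simp [List.getD_eq_getElem?_getD, hψ, hFc]
      · simp only [hF, dif_neg (show ¬ ∃ φ : Formula A, φ.code = n from hn)]
  exact (hrec.comp Primrec.fst (Primrec.encode.comp Primrec.snd)).of_eq fun p => hFc p.1 p.2

theorem primrecPred_structural_rec {P : α → Formula A → Prop}
    {Q : (α × ℕ × ℕ × ℕ) × (Bool × Bool) → Prop} (hQ : PrimrecPred Q)
    (h : ∀ (a : α) (φ : Formula A) (r : ℕ → Bool), (∀ ψ : Formula A, ψ.code < φ.code →
      (r ψ.code = true ↔ P a ψ)) → (P a φ ↔ Q ((a, φ.code.unpair.1, φ.code.unpair.2.unpair.1,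
        φ.code.unpair.2.unpair.2),
        (r φ.code.unpair.2.unpair.1, r φ.code.unpair.2.unpair.2)))) : PrimrecRel P := by
  classical
  refine ⟨fun _ => inferInstance, ?_⟩
  refine primrec_structural_rec (f := fun a φ => decide (P a φ)) false hQ.decide
    fun a φ r hr => ?_
  rw [decide_eq_decide]
  exact h a φ r fun ψ hψ => by rw [hr ψ hψ, decide_eq_true_iff]

variable (α) in
/-- The components of the Gödel number are primitive recursive in the data of a recursion step. -/
theorem primrec_shape : Primrec (fun x : (α × ℕ × ℕ × ℕ) × (σ × σ) => x.1.2.1) ∧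
    Primrec (fun x : (α × ℕ × ℕ × ℕ) × (σ × σ) => x.1.2.2.1) ∧
    Primrec (fun x : (α × ℕ × ℕ × ℕ) × (σ × σ) => x.1.2.2.2) := by
  have h := Primrec.snd.comp (Primrec.fst (α := α × ℕ × ℕ × ℕ) (β := σ × σ))
  exact ⟨Primrec.fst.comp h, Primrec.fst.comp (Primrec.snd.comp h),
    Primrec.snd.comp (Primrec.snd.comp h)⟩

theorem primrecPred_inLang (L : Logic) : PrimrecPred fun φ : Formula A => φ.InLang L := by
  obtain ⟨hk, -, -⟩ := primrec_shape (σ := Bool) Unit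
  have eqk (c : ℕ) := Primrec.eq.comp hk (Primrec.const c)
  have h1 := Primrec.eq.comp (Primrec.fst.comp (Primrec.snd (α := Unit × ℕ × ℕ × ℕ)
    (β := Bool × Bool))) (Primrec.const true)
  have h2 := Primrec.eq.comp (Primrec.snd.comp (Primrec.snd (α := Unit × ℕ × ℕ × ℕ)
    (β := Bool × Bool))) (Primrec.const true)
  refine PrimrecRel.comp (R := fun (_ : Unit) (φ : Formula A) => φ.InLang L)
    (primrecPred_structural_rec (P := fun _ φ => φ.InLang L)
    ((Primrec.nat_lt.comp hk (Primrec.const 4)).or <|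
      (((eqk 4).or (eqk 5)).and (primrecPred_const L.HasEq)).or <|
      (((eqk 6).or (eqk 7)).and (h1.and h2)).or <| (((eqk 8).or (eqk 9)).and h2).or <|
      (((eqk 10).or (eqk 11)).and ((primrecPred_const L.HasInf).and h2))) ?_)
    (Primrec.const ()) Primrec.id
  intro _ φ r hr
  cases φ with
  | or φ ψ =>
    obtain ⟨h1, h2⟩ := code_lt_binary 6 (by simp) φ ψ
    simp [code, InLang, hr φ h1, hr ψ h2]
  | and φ ψ =>
    obtain ⟨h1, h2⟩ := code_lt_binary 7 (by simp) φ ψ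
    simp [code, InLang, hr φ h1, hr ψ h2]
  | ex x φ => simp [code, InLang, hr φ (code_lt_quantifier 8 (by simp) x φ).2]
  | all x φ => simp [code, InLang, hr φ (code_lt_quantifier 9 (by simp) x φ).2]
  | exInf x φ => simp [code, InLang, hr φ (code_lt_quantifier 10 (by simp) x φ).2]
  | allInf x φ => simp [code, InLang, hr φ (code_lt_quantifier 11 (by simp) x φ).2]
  | _ => simp [code, InLang]

theorem primrecPred_inUniv (L : Logic) : PrimrecPred fun φ : Formula A => φ.InUniv L := by
  obtain ⟨hk, -, -⟩ := primrec_shape (σ := Bool) Unit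
  have eqk (c : ℕ) := Primrec.eq.comp hk (Primrec.const c)
  have h1 := Primrec.eq.comp (Primrec.fst.comp (Primrec.snd (α := Unit × ℕ × ℕ × ℕ)
    (β := Bool × Bool))) (Primrec.const true)
  have h2 := Primrec.eq.comp (Primrec.snd.comp (Primrec.snd (α := Unit × ℕ × ℕ × ℕ)
    (β := Bool × Bool))) (Primrec.const true)
  refine PrimrecRel.comp (R := fun (_ : Unit) (φ : Formula A) => φ.InUniv L)
    (primrecPred_structural_rec (P := fun _ φ => φ.InUniv L)
    ((Primrec.nat_lt.comp hk (Primrec.const 4)).or <|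
      (((eqk 4).or (eqk 5)).and (primrecPred_const L.HasEq)).or <|
      (((eqk 6).or (eqk 7)).and (h1.and h2)).or <| ((eqk 9).and h2).or <|
      ((eqk 11).and ((primrecPred_const L.HasInf).and h2))) ?_)
    (Primrec.const ()) Primrec.id
  intro _ φ r hr
  cases φ with
  | or φ ψ =>
    obtain ⟨h1, h2⟩ := code_lt_binary 6 (by simp) φ ψ
    simp [code, InUniv, hr φ h1, hr ψ h2]
  | and φ ψ =>
    obtain ⟨h1, h2⟩ := code_lt_binary 7 (by simp) φ ψ
    simp [code, InUniv, hr φ h1, hr ψ h2]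
  | all x φ => simp [code, InUniv, hr φ (code_lt_quantifier 9 (by simp) x φ).2]
  | allInf x φ => simp [code, InUniv, hr φ (code_lt_quantifier 11 (by simp) x φ).2]
  | _ => simp [code, InUniv]

theorem primrecRel_mem_freeVars :
    PrimrecRel fun (x : ℕ) (φ : Formula A) => x ∈ φ.freeVars := by
  obtain ⟨hk, hp, hq⟩ := primrec_shape (σ := Bool) ℕ
  have eqk (c : ℕ) := Primrec.eq.comp hk (Primrec.const c)
  have hx := Primrec.fst.comp (Primrec.fst (α := ℕ × ℕ × ℕ × ℕ) (β := Bool × Bool))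
  have h1 := Primrec.eq.comp (Primrec.fst.comp (Primrec.snd (α := ℕ × ℕ × ℕ × ℕ)
    (β := Bool × Bool))) (Primrec.const true)
  have h2 := Primrec.eq.comp (Primrec.snd.comp (Primrec.snd (α := ℕ × ℕ × ℕ × ℕ)
    (β := Bool × Bool))) (Primrec.const true)
  refine primrecPred_structural_rec (P := fun (x : ℕ) φ => x ∈ φ.freeVars)
    ((((eqk 2).or (eqk 3)).and (Primrec.eq.comp hx hq)).or <|
      (((eqk 4).or (eqk 5)).and ((Primrec.eq.comp hx hp).or (Primrec.eq.comp hx hq))).or <|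
      (((eqk 6).or (eqk 7)).and (h1.or h2)).or <|
      ((Primrec.nat_le.comp (Primrec.const 8) hk).and ((Primrec.eq.comp hx hp).not.and h2))) ?_
  intro y φ r hr
  cases φ with
  | or φ ψ =>
    obtain ⟨h1, h2⟩ := code_lt_binary 6 (by simp) φ ψ
    simp [code, freeVars, hr φ h1, hr ψ h2]
  | and φ ψ =>
    obtain ⟨h1, h2⟩ := code_lt_binary 7 (by simp) φ ψ
    simp [code, freeVars, hr φ h1, hr ψ h2]
  | ex x φ => simp [code, freeVars, hr φ (code_lt_quantifier 8 (by simp) x φ).2]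
  | all x φ => simp [code, freeVars, hr φ (code_lt_quantifier 9 (by simp) x φ).2]
  | exInf x φ => simp [code, freeVars, hr φ (code_lt_quantifier 10 (by simp) x φ).2]
  | allInf x φ => simp [code, freeVars, hr φ (code_lt_quantifier 11 (by simp) x φ).2]
  | _ => simp [code, freeVars]

theorem primrecPred_isSentence : PrimrecPred fun φ : Formula A => φ.IsSentence := by
  refine (primrecPred_forall_mem (f := fun φ : Formula A => List.range φ.code)
    (Primrec.list_range.comp Primrec.encode) (p := fun φ x => x ∉ φ.freeVars)
    (primrecRel_mem_freeVars.comp Primrec.snd Primrec.fst).not).of_eq fun φ => ?_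
  refine ⟨fun h => Finset.eq_empty_of_forall_notMem fun x hx => ?_, fun h x _ => ?_⟩
  · exact h x (List.mem_range.2 (lt_code_of_mem_freeVars hx)) hx
  · simp [show φ.freeVars = ∅ from h]

end Formula
end MonadicPred

/-! ### Evaluation of sentences at a profile -/

namespace MonadicPred
open Function

namespace FlaggedModel
variable {A : Type u}

/-- Truth of a formula with variables below `N` depends only on the values of these variables. -/
theorem sat_congr [Encodable A] (F : FlaggedModel.{u, w} A) {N : ℕ} {φ : Formula A}
    (hN : φ.code ≤ N) {g g' : ℕ → F.Dom} (h : ∀ y < N, g y = g' y) :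
    F.Sat N g φ ↔ F.Sat N g' φ := by
  have hB : BackAndForth .FOEInf N F F (fun _ g g' => ∀ y < N, g y = g' y) := by
    have hup : ∀ {g g' : ℕ → F.Dom}, (∀ y < N, g y = g' y) → ∀ x d, ∀ y < N,
        update g x d y = update g' x d y := by
      intro g g' h x d y hy
      by_cases hyx : y = x
      · subst hyx; simp
      · simp [hyx, h y hy]
    refine ⟨fun h x hx => by rw [h x hx], fun _ h x hx y hy => by rw [h x hx, h y hy],
      fun h x _ d hd => ⟨d, hd, hup h x d, fun _ => Iff.rfl⟩,
      fun h x _ d hd => ⟨d, hd, hup h x d, fun _ => Iff.rfl⟩⟩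
  exact ⟨hB.sat φ.inLang_foeInf hN hN h,
    hB.sat φ.inLang_foeInf hN hN fun y hy => (h y hy).symm⟩

theorem sat_of_carrier_eq_empty (F : FlaggedModel.{u, w} A) (h0 : F.carrier = ∅) (N : ℕ)
    {φ : Formula A} (hs : φ.IsSentence) (g : ℕ → F.Dom) : F.Sat N g φ ↔ φ.TrueInEmpty := by
  unfold Formula.IsSentence at hs
  induction φ with
  | top | bot => rfl
  | pos | neg | eq | ne => simp [Formula.freeVars] at hs
  | or φ ψ ih₁ ih₂ | and φ ψ ih₁ ih₂ =>
    rw [Formula.freeVars, Finset.union_eq_empty] at hs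
    simp only [Sat, Formula.TrueInEmpty, ih₁ hs.1, ih₂ hs.2]
  | ex | all | exInf | allInf => simp [Sat, Formula.TrueInEmpty, h0]

end FlaggedModel

section Evaluation
variable {A : Type u}

/-- A list as an assignment of elements to variables. -/
def assignment (c : List (Set A × ℕ)) (y : ℕ) : Set A × ℕ := c.getD y (∅, 0)

theorem assignment_set {c : List (Set A × ℕ)} {x : ℕ} (hx : x < c.length) (d : Set A × ℕ) :
    assignment (c.set x d) = update (assignment c) x d := by
  funext y
  by_cases hyx : y = x
  · subst hyx
    simp [assignment, List.getD_eq_getElem?_getD, hx]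
  · simp [assignment, List.getD_eq_getElem?_getD, hyx, List.getElem?_set_ne (Ne.symm hyx)]

variable [Finite A]

/-- Types are coded by an arbitrary numbering. -/
noncomputable instance instPrimcodableType : Primcodable (Set A) :=
  Primcodable.ofEquiv (Fin (Nat.card (Set A))) (Finite.equivFin (Set A))

/-- A list of natural numbers as a profile, through a numbering of the types. -/
noncomputable def profileOf (l : List ℕ) (τ : Set A) : ℕ := l.getD (Finite.equivFin (Set A) τ) 0

variable (A) in
theorem exists_profileOf_eq {K : ℕ} {v : Set A → ℕ} (hv : ∀ τ, v τ ≤ K) :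
    ∃ l ∈ listsOf (List.range (K + 1)) (Nat.card (Set A)), profileOf l = v := by
  refine ⟨List.ofFn fun i => v ((Finite.equivFin (Set A)).symm i), mem_listsOf.2 ⟨by simp, ?_⟩, ?_⟩
  · intro b hb
    obtain ⟨i, rfl⟩ := (List.mem_ofFn' _ _).1 hb
    exact List.mem_range.2 (Nat.lt_succ_of_le (hv _))
  · funext τ
    simp [profileOf, List.getD_eq_getElem?_getD]

theorem profileOf_le {K n : ℕ} {l : List ℕ} (hl : l ∈ listsOf (List.range (K + 1)) n)
    (τ : Set A) : profileOf l τ ≤ K := by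
  have h := (mem_listsOf.1 hl).2
  unfold profileOf
  rcases lt_or_ge (Finite.equivFin (Set A) τ).1 l.length with hlt | hge
  · rw [List.getD_eq_getElem _ _ hlt]
    exact Nat.le_of_lt_succ (List.mem_range.1 (h _ (List.getElem_mem _)))
  · rw [List.getD_eq_default _ _ hge]
    exact K.zero_le

theorem primrec_profileOf : Primrec₂ (profileOf : List ℕ → Set A → ℕ) :=
  (Primrec.list_getD 0).comp Primrec.fst (Primrec.encode.comp Primrec.snd)

/-- The lists that describe all profiles with values at most `N + 2`. -/
noncomputable def profileLists (A : Type u) [Finite A] (N : ℕ) : List (List ℕ) :=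
  listsOf (List.range (N + 3)) (Nat.card (Set A))

theorem primrec_profileLists : Primrec (profileLists A) :=
  primrec_listsOf.comp (Primrec.list_range.comp
    (Primrec.nat_add.comp Primrec.id (Primrec.const 3))) (Primrec.const _)

open Classical in
/-- The elements that the finite flagged models with threshold `K` can have. -/
noncomputable def elements (A : Type u) [Finite A] (K : ℕ) : List (Set A × ℕ) :=
  letI := Fintype.ofFinite (Set A)
  (Finset.univ : Finset (Set A)).toList.flatMap fun τ => (List.range K).map fun i => (τ, i)

theorem mem_elements {K : ℕ} {d : Set A × ℕ} : d ∈ elements A K ↔ d.2 < K := by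
  obtain ⟨τ, i⟩ := d
  simp [elements]

theorem primrec_elements : Primrec (elements A) :=
  Primrec.list_flatMap (Primrec.const _) (Primrec.list_map (Primrec.list_range.comp Primrec.fst)
    (Primrec.pair (Primrec.snd.comp Primrec.fst) Primrec.snd))

theorem primrec_assignment : Primrec₂ (assignment : List (Set A × ℕ) → ℕ → Set A × ℕ) :=
  Primrec.list_getD (∅, 0)

/-- The finite flagged model whose profile is described by the list `a.1`, with threshold
`a.2 + 1`. -/
noncomputable abbrev listModel (A : Type u) [Finite A] (a : List ℕ × ℕ) : FlaggedModel.{u, u} A :=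
  FlaggedModel.ofProfile (a.2 + 1) (profileOf a.1)

theorem primrecRel_mem_carrier : PrimrecRel fun (a : List ℕ × ℕ) (d : Set A × ℕ) =>
    d ∈ (listModel A a).carrier := by
  have hd : Primrec fun x : (List ℕ × ℕ) × (Set A × ℕ) => x.2.2 := Primrec.snd.comp Primrec.snd
  exact (Primrec.nat_lt.comp hd (Primrec.succ.comp (Primrec.snd.comp Primrec.fst))).and
    (Primrec.nat_lt.comp hd (primrec_profileOf.comp (Primrec.fst.comp Primrec.fst)
      (Primrec.fst.comp Primrec.snd)))

theorem primrecRel_big : PrimrecRel fun (a : List ℕ × ℕ) (d : Set A × ℕ) =>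
    (listModel A a).big d :=
  Primrec.eq.comp (primrec_profileOf.comp (Primrec.fst.comp Primrec.fst)
    (Primrec.fst.comp Primrec.snd))
    (Primrec.succ.comp (Primrec.succ.comp (Primrec.snd.comp Primrec.fst)))

variable [Primcodable A]

theorem primrecRel_mem_type :
    PrimrecRel fun (p : ℕ) (τ : Set A) => ∃ a : A, Encodable.encode a = p ∧ a ∈ τ := by
  classical
  have h : Primrec fun x : Option A × Set A => decide (∃ a, x.1 = some a ∧ a ∈ x.2) :=
    Primrec.dom_finite _
  refine ((h.comp (Primrec.pair ((Primrec.decode₂).comp Primrec.fst) Primrec.snd)).primrecPred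
    (p := fun x : ℕ × Set A => ∃ a, Encodable.decode₂ A x.1 = some a ∧ a ∈ x.2)).of_eq fun x => ?_
  exact exists_congr fun a => and_congr_left fun _ => Encodable.decode₂_eq_some

open Classical in
/-- The truth table of a formula in the model described by `a.1`: the assignments of the variables
below `a.2` that satisfy it.  It is empty by convention if a variable of the formula may be out of
range, where updating a list differs from updating an assignment. -/
noncomputable def truthTable (a : List ℕ × ℕ) (φ : Formula A) : List (List (Set A × ℕ)) :=
  (listsOf (elements A (a.2 + 1)) a.2).filter fun c =>
    φ.code ≤ a.2 ∧ (listModel A a).Sat a.2 (assignment c) φ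

theorem mem_truthTable {a : List ℕ × ℕ} {φ : Formula A} {c : List (Set A × ℕ)} :
    c ∈ truthTable a φ ↔ c ∈ listsOf (elements A (a.2 + 1)) a.2 ∧
      φ.code ≤ a.2 ∧ (listModel A a).Sat a.2 (assignment c) φ := by
  simp [truthTable]

theorem set_mem_truthTable {a : List ℕ × ℕ} {φ : Formula A} {c : List (Set A × ℕ)}
    (hc : c ∈ listsOf (elements A (a.2 + 1)) a.2) (hφ : φ.code ≤ a.2) {x : ℕ} (hx : x < a.2)
    {d : Set A × ℕ} (hd : d ∈ (listModel A a).carrier) :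
    c.set x d ∈ truthTable a φ ↔
      (listModel A a).Sat a.2 (update (assignment c) x d : ℕ → Set A × ℕ) φ := by
  obtain ⟨h1, h2⟩ := mem_listsOf.1 hc
  have hc' : c.set x d ∈ listsOf (elements A (a.2 + 1)) a.2 := by
    refine mem_listsOf.2 ⟨by simpa using h1, fun b hb => ?_⟩
    rcases List.mem_or_eq_of_mem_set hb with hb | rfl
    · exact h2 b hb
    · exact mem_elements.2 hd.1
  rw [mem_truthTable, and_iff_right hc', and_iff_right hφ, assignment_set (h1 ▸ hx)]

/-- The step of the recursion that computes truth tables: the assignment `c` belongs to the table of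
the formula with Gödel number `⟨k, p, q⟩`, where `T₁` and `T₂` are the tables of the formulas with
Gödel numbers `p` and `q`.  The tag `k` names the outermost constructor. -/
def TableStep (a : List ℕ × ℕ) (k p q : ℕ) (T₁ T₂ : List (List (Set A × ℕ)))
    (c : List (Set A × ℕ)) : Prop :=
  Nat.pair k (Nat.pair p q) ≤ a.2 ∧
  (k = 0 ∨
  (k = 2 ∧ ∃ b : A, Encodable.encode b = p ∧ b ∈ (assignment c q).1) ∨
  (k = 3 ∧ ¬ ∃ b : A, Encodable.encode b = p ∧ b ∈ (assignment c q).1) ∨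
  (k = 4 ∧ assignment c p = assignment c q) ∨
  (k = 5 ∧ ¬ assignment c p = assignment c q) ∨
  (k = 6 ∧ (c ∈ T₁ ∨ c ∈ T₂)) ∨
  (k = 7 ∧ (c ∈ T₁ ∧ c ∈ T₂)) ∨
  (k = 8 ∧ ∃ d ∈ elements A (a.2 + 1), d ∈ (listModel A a).carrier ∧ c.set p d ∈ T₂) ∨
  (k = 9 ∧ ∀ d ∈ elements A (a.2 + 1), d ∈ (listModel A a).carrier → c.set p d ∈ T₂) ∨
  (k = 10 ∧ ∃ d ∈ elements A (a.2 + 1), d ∈ (listModel A a).carrier ∧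
    ((listModel A a).big d ∧ ∀ y ∈ List.range a.2, ¬ y = p → ¬ assignment c y = d) ∧
    c.set p d ∈ T₂) ∨
  (k = 11 ∧ ∀ d ∈ elements A (a.2 + 1), d ∈ (listModel A a).carrier →
    ((listModel A a).big d ∧ ∀ y ∈ List.range a.2, ¬ y = p → ¬ assignment c y = d) →
    c.set p d ∈ T₂))

theorem primrecPred_tableStep : PrimrecPred fun x : (((List ℕ × ℕ) × ℕ × ℕ × ℕ) ×
    (List (List (Set A × ℕ)) × List (List (Set A × ℕ)))) × List (Set A × ℕ) =>
    TableStep x.1.1.1 x.1.1.2.1 x.1.1.2.2.1 x.1.1.2.2.2 x.1.2.1 x.1.2.2 x.2 := by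
  obtain ⟨hk, hp, hq⟩ := Formula.primrec_shape (σ := List (List (Set A × ℕ))) (List ℕ × ℕ)
  replace hk := hk.comp (Primrec.fst (β := List (Set A × ℕ)))
  replace hp := hp.comp (Primrec.fst (β := List (Set A × ℕ)))
  replace hq := hq.comp (Primrec.fst (β := List (Set A × ℕ)))
  have ha : Primrec fun x : (((List ℕ × ℕ) × ℕ × ℕ × ℕ) × (List (List (Set A × ℕ)) ×
      List (List (Set A × ℕ)))) × List (Set A × ℕ) => x.1.1.1 :=
    Primrec.fst.comp (Primrec.fst.comp Primrec.fst)
  have hT₁ : Primrec fun x : (((List ℕ × ℕ) × ℕ × ℕ × ℕ) × (List (List (Set A × ℕ)) ×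
      List (List (Set A × ℕ)))) × List (Set A × ℕ) => x.1.2.1 :=
    Primrec.fst.comp (Primrec.snd.comp Primrec.fst)
  have hT₂ : Primrec fun x : (((List ℕ × ℕ) × ℕ × ℕ × ℕ) × (List (List (Set A × ℕ)) ×
      List (List (Set A × ℕ)))) × List (Set A × ℕ) => x.1.2.2 :=
    Primrec.snd.comp (Primrec.snd.comp Primrec.fst)
  have hc : Primrec fun x : (((List ℕ × ℕ) × ℕ × ℕ × ℕ) × (List (List (Set A × ℕ)) ×
      List (List (Set A × ℕ)))) × List (Set A × ℕ) => x.2 := Primrec.snd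
  have hN := Primrec.snd.comp ha
  have eqk (n : ℕ) := Primrec.eq.comp hk (Primrec.const n)
  have hpos := primrecRel_mem_type.comp hp (Primrec.fst.comp (primrec_assignment.comp hc hq))
  have heq := Primrec.eq.comp (primrec_assignment.comp hc hp) (primrec_assignment.comp hc hq)
  have hel := primrec_elements (A := A) |>.comp (Primrec.succ.comp hN)
  have hcar := primrecRel_mem_carrier (A := A) |>.comp (ha.comp (Primrec.fst (β := Set A × ℕ)))
    Primrec.snd
  have hbig := primrecRel_big (A := A) |>.comp (ha.comp (Primrec.fst (β := Set A × ℕ)))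
    Primrec.snd
  have hset := primrecPred_mem (hT₂.comp (Primrec.fst (β := Set A × ℕ)))
    (Primrec.list_set.comp (hc.comp Primrec.fst)
      (Primrec.pair (hp.comp Primrec.fst) Primrec.snd))
  have hfresh := primrecPred_forall_mem
    (Primrec.list_range.comp (hN.comp (Primrec.fst (β := Set A × ℕ))))
    (p := fun x y => ¬ y = x.1.1.1.2.2.1 → ¬ assignment x.1.2 y = x.2)
    ((Primrec.eq.comp Primrec.snd (hp.comp (Primrec.fst.comp Primrec.fst))).not.imp
      (Primrec.eq.comp (primrec_assignment.comp (hc.comp (Primrec.fst.comp Primrec.fst))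
        Primrec.snd) (Primrec.snd.comp Primrec.fst)).not)
  exact (Primrec.nat_le.comp (Primrec₂.natPair.comp hk (Primrec₂.natPair.comp hp hq)) hN).and <|
    (eqk 0).or <| ((eqk 2).and hpos).or <| ((eqk 3).and hpos.not).or <| ((eqk 4).and heq).or <|
    ((eqk 5).and heq.not).or <|
    ((eqk 6).and ((primrecPred_mem hT₁ hc).or (primrecPred_mem hT₂ hc))).or <|
    ((eqk 7).and ((primrecPred_mem hT₁ hc).and (primrecPred_mem hT₂ hc))).or <|
    ((eqk 8).and (primrecPred_exists_mem hel (hcar.and hset))).or <|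
    ((eqk 9).and (primrecPred_forall_mem hel (hcar.imp hset))).or <|
    ((eqk 10).and (primrecPred_exists_mem hel (hcar.and ((hbig.and hfresh).and hset)))).or <|
    (eqk 11).and (primrecPred_forall_mem hel (hcar.imp ((hbig.and hfresh).imp hset)))

theorem primrec_truthTable :
    Primrec₂ (truthTable : List ℕ × ℕ → Formula A → List (List (Set A × ℕ))) := by
  classical
  have hR : PrimrecRel fun (c : List (Set A × ℕ)) (x : ((List ℕ × ℕ) × ℕ × ℕ × ℕ) ×
      (List (List (Set A × ℕ)) × List (List (Set A × ℕ)))) =>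
      TableStep x.1.1 x.1.2.1 x.1.2.2.1 x.1.2.2.2 x.2.1 x.2.2 c :=
    primrecPred_tableStep.comp (Primrec.pair Primrec.snd Primrec.fst)
  have hN : Primrec fun x : ((List ℕ × ℕ) × ℕ × ℕ × ℕ) × (List (List (Set A × ℕ)) ×
      List (List (Set A × ℕ))) => x.1.1.2 := Primrec.snd.comp (Primrec.fst.comp Primrec.fst)
  refine Formula.primrec_structural_rec [] (hR.listFilter.comp (primrec_listsOf.comp
    (primrec_elements.comp (Primrec.succ.comp hN)) hN) Primrec.id) fun a φ r hr => ?_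
  refine List.filter_congr fun c hc => ?_
  rw [decide_eq_decide]
  unfold TableStep
  simp only [id_eq, Nat.pair_unpair]
  refine and_congr_right fun hφ => ?_
  have hel : ∀ d : Set A × ℕ, d ∈ (listModel A a).carrier → d ∈ elements A (a.2 + 1) :=
    fun d hd => mem_elements.2 hd.1
  cases φ with
  | top | bot => simp [Formula.code, FlaggedModel.Sat]
  | eq x y | ne x y =>
    simp [Formula.code, FlaggedModel.Sat]
    rfl
  | pos b x | neg b x =>
    simp [Formula.code, FlaggedModel.Sat, Encodable.encode_inj]
    rfl
  | or φ ψ =>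
    obtain ⟨h1, h2⟩ := Formula.code_lt_binary 6 (by simp) φ ψ
    simp [Formula.code, FlaggedModel.Sat, hr φ h1, hr ψ h2, mem_truthTable, hc, h1.le.trans hφ,
      h2.le.trans hφ]
  | and φ ψ =>
    obtain ⟨h1, h2⟩ := Formula.code_lt_binary 7 (by simp) φ ψ
    simp [Formula.code, FlaggedModel.Sat, hr φ h1, hr ψ h2, mem_truthTable, hc, h1.le.trans hφ,
      h2.le.trans hφ]
  | ex x φ =>
    obtain ⟨h1, h2⟩ := Formula.code_lt_quantifier 8 (by simp) x φ
    have hset : ∀ d ∈ (listModel A a).carrier, _ := fun d hd =>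
      set_mem_truthTable hc (h2.le.trans hφ) (h1.trans_le hφ) hd
    simp only [Formula.code, Nat.unpair_pair, hr φ h2, Nat.reduceEqDiff, OfNat.ofNat_ne_zero,
      false_and, true_and, false_or, or_false]
    exact ⟨fun ⟨d, hd, h⟩ => ⟨d, hel d hd, hd, (hset d hd).2 h⟩,
      fun ⟨d, _, hd, h⟩ => ⟨d, hd, (hset d hd).1 h⟩⟩
  | all x φ =>
    obtain ⟨h1, h2⟩ := Formula.code_lt_quantifier 9 (by simp) x φ
    have hset : ∀ d ∈ (listModel A a).carrier, _ := fun d hd =>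
      set_mem_truthTable hc (h2.le.trans hφ) (h1.trans_le hφ) hd
    simp only [Formula.code, Nat.unpair_pair, hr φ h2, Nat.reduceEqDiff, OfNat.ofNat_ne_zero,
      false_and, true_and, false_or, or_false]
    exact ⟨fun h d _ hd => (hset d hd).2 (h d hd),
      fun h d hd => (hset d hd).1 (h d (hel d hd) hd)⟩
  | exInf x φ =>
    obtain ⟨h1, h2⟩ := Formula.code_lt_quantifier 10 (by simp) x φ
    have hset : ∀ d ∈ (listModel A a).carrier, _ := fun d hd =>
      set_mem_truthTable hc (h2.le.trans hφ) (h1.trans_le hφ) hd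
    simp only [Formula.code, Nat.unpair_pair, hr φ h2, Nat.reduceEqDiff, OfNat.ofNat_ne_zero,
      false_and, true_and, false_or, or_false]
    simp only [List.mem_range]
    exact ⟨fun ⟨d, hd, hb, h⟩ => ⟨d, hel d hd, hd, hb, (hset d hd).2 h⟩,
      fun ⟨d, _, hd, hb, h⟩ => ⟨d, hd, hb, (hset d hd).1 h⟩⟩
  | allInf x φ =>
    obtain ⟨h1, h2⟩ := Formula.code_lt_quantifier 11 (by simp) x φ
    have hset : ∀ d ∈ (listModel A a).carrier, _ := fun d hd =>
      set_mem_truthTable hc (h2.le.trans hφ) (h1.trans_le hφ) hd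
    simp only [Formula.code, Nat.unpair_pair, hr φ h2, Nat.reduceEqDiff, OfNat.ofNat_ne_zero,
      false_and, true_and, false_or]
    simp only [List.mem_range]
    exact ⟨fun h d _ hd hb => (hset d hd).2 (h d hd hb),
      fun h d hd hb => (hset d hd).1 (h d (hel d hd) hd hb)⟩

/-- Truth of a sentence in the model described by a list, in terms of truth tables.  All variables
get the same value, which is a junk value if the carrier is empty. -/
def ListHolds (a : List ℕ × ℕ) (φ : Formula A) : Prop :=
  ∃ d ∈ elements A (a.2 + 1), (d ∈ (listModel A a).carrier ∨
    ∀ d' ∈ elements A (a.2 + 1), d' ∉ (listModel A a).carrier) ∧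
    (List.range a.2).map (fun _ => d) ∈ truthTable a φ

theorem primrecRel_listHolds : PrimrecRel (ListHolds : List ℕ × ℕ → Formula A → Prop) := by
  have hel : Primrec fun x : (List ℕ × ℕ) × Formula A => elements A (x.1.2 + 1) :=
    primrec_elements.comp (Primrec.succ.comp (Primrec.snd.comp Primrec.fst))
  refine primrecPred_exists_mem hel ((PrimrecPred.or ?_ ?_).and ?_)
  · exact primrecRel_mem_carrier.comp (Primrec.fst.comp Primrec.fst) Primrec.snd
  · exact primrecPred_forall_mem (hel.comp Primrec.fst) (primrecRel_mem_carrier.comp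
      (Primrec.fst.comp (Primrec.fst.comp Primrec.fst)) Primrec.snd).not
  · refine primrecPred_mem (primrec_truthTable.comp (Primrec.fst.comp Primrec.fst)
      (Primrec.snd.comp Primrec.fst)) (Primrec.list_map (Primrec.list_range.comp
      (Primrec.snd.comp (Primrec.fst.comp Primrec.fst))) (Primrec.snd.comp Primrec.fst))

theorem listHolds_iff {a : List ℕ × ℕ} {φ : Formula A} (hφ : φ.code ≤ a.2)
    (hs : φ.IsSentence) : ListHolds a φ ↔ (listModel A a).Holds a.2 φ := by
  have hel : ∀ d : Set A × ℕ, d ∈ (listModel A a).carrier → d ∈ elements A (a.2 + 1) :=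
    fun d hd => mem_elements.2 hd.1
  have htab : ∀ d ∈ elements A (a.2 + 1), (List.range a.2).map (fun _ => d) ∈ truthTable a φ ↔
      (listModel A a).Sat a.2 (fun _ => d) φ := by
    intro d hd
    rw [mem_truthTable, and_iff_right (mem_listsOf.2 ⟨by simp, by simp [hd]⟩), and_iff_right hφ]
    refine FlaggedModel.sat_congr _ hφ fun y hy => ?_
    simp [assignment, List.getD_eq_getElem?_getD, hy]
    rfl
  constructor
  · rintro ⟨d, hd, hd' | h0, ht⟩
    · exact .inr ⟨d, hd', (htab d hd).1 ht⟩
    · have he : (listModel A a).carrier = ∅ :=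
        Set.eq_empty_of_forall_notMem fun d hd => h0 d (hel d hd) hd
      exact .inl ⟨he, (FlaggedModel.sat_of_carrier_eq_empty _ he _ hs _).1 ((htab d hd).1 ht)⟩
  · rintro (⟨he, h⟩ | ⟨d, hd, h⟩)
    · have hd : ((∅, 0) : Set A × ℕ) ∈ elements A (a.2 + 1) := mem_elements.2 a.2.succ_pos
      refine ⟨_, hd, .inr fun d' _ hd' => ?_, (htab _ hd).2
        ((FlaggedModel.sat_of_carrier_eq_empty _ he _ hs _).2 h)⟩
      rw [he] at hd'
      exact hd'
    · exact ⟨d, hel d hd, .inl hd, (htab d (hel d hd)).2 h⟩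

theorem preserved_iff_listHolds {φ : Formula A} (hs : φ.IsSentence) :
    PreservedUnderSubmodels.{u, v} φ ↔ ∀ l ∈ profileLists A φ.code, ∀ l' ∈ profileLists A φ.code,
      (∀ i ∈ List.range (Nat.card (Set A)), l'.getD i 0 ≤ l.getD i 0) →
      ListHolds (l, φ.code) φ → ListHolds (l', φ.code) φ := by
  rw [Model.preserved_iff_profile le_rfl hs]
  constructor
  · intro h l hl l' hl' hle
    rw [listHolds_iff le_rfl hs, listHolds_iff le_rfl hs]
    exact h _ _ (profileOf_le hl) fun τ => hle _ (List.mem_range.2 (Fin.is_lt _))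
  · intro h v w hv hwv
    obtain ⟨l, hl, rfl⟩ := exists_profileOf_eq A hv
    obtain ⟨l', hl', rfl⟩ := exists_profileOf_eq A fun τ => (hwv τ).trans (hv τ)
    have := h l hl l' hl' fun i hi => ?_
    · rwa [listHolds_iff le_rfl hs, listHolds_iff le_rfl hs] at this
    · have := hwv ((Finite.equivFin (Set A)).symm ⟨i, List.mem_range.1 hi⟩)
      simpa [profileOf] using this

theorem equivalent_iff_listHolds {φ ψ : Formula A} (hs : φ.IsSentence)
    (hs' : ψ.IsSentence) : Equivalent.{u, v} φ ψ ↔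
      ∀ l ∈ profileLists A (φ.code + ψ.code),
        (ListHolds (l, φ.code + ψ.code) φ ↔ ListHolds (l, φ.code + ψ.code) ψ) := by
  rw [Model.equivalent_iff_profile (N := φ.code + ψ.code) (by omega) hs (by omega) hs']
  constructor
  · intro h l hl
    rw [listHolds_iff (a := (l, φ.code + ψ.code)) (Nat.le_add_right _ _) hs,
      listHolds_iff (a := (l, φ.code + ψ.code)) (Nat.le_add_left _ _) hs']
    exact h _ (profileOf_le hl)
  · intro h v hv
    obtain ⟨l, hl, rfl⟩ := exists_profileOf_eq A hv
    have := h l hl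
    rwa [listHolds_iff (a := (l, φ.code + ψ.code)) (Nat.le_add_right _ _) hs,
      listHolds_iff (a := (l, φ.code + ψ.code)) (Nat.le_add_left _ _) hs'] at this

theorem primrecPred_preserved (L : Logic) : PrimrecPred fun φ : Formula A =>
    φ.InLang L ∧ φ.IsSentence ∧ PreservedUnderSubmodels.{u, v} φ := by
  have hlists : Primrec fun φ : Formula A => profileLists A φ.code :=
    primrec_profileLists.comp Primrec.encode
  have h : PrimrecPred fun φ : Formula A => ∀ l ∈ profileLists A φ.code,
      ∀ l' ∈ profileLists A φ.code,
      (∀ i ∈ List.range (Nat.card (Set A)), l'.getD i 0 ≤ l.getD i 0) →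
      ListHolds (l, φ.code) φ → ListHolds (l', φ.code) φ := by
    refine primrecPred_forall_mem hlists (primrecPred_forall_mem (hlists.comp Primrec.fst) ?_)
    have hφ : Primrec fun x : (Formula A × List ℕ) × List ℕ => x.1.1 :=
      Primrec.fst.comp Primrec.fst
    have hl : Primrec fun x : (Formula A × List ℕ) × List ℕ => x.1.2 :=
      Primrec.snd.comp Primrec.fst
    refine PrimrecPred.imp (primrecPred_forall_mem (Primrec.const _) ?_) (PrimrecPred.imp ?_ ?_)
    · exact Primrec.nat_le.comp
        ((Primrec.list_getD 0).comp (Primrec.snd.comp Primrec.fst) Primrec.snd)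
        ((Primrec.list_getD 0).comp (hl.comp Primrec.fst) Primrec.snd)
    · exact primrecRel_listHolds.comp (Primrec.pair hl (Primrec.encode.comp hφ)) hφ
    · exact primrecRel_listHolds.comp (Primrec.pair Primrec.snd (Primrec.encode.comp hφ)) hφ
  refine ((Formula.primrecPred_inLang L).and (Formula.primrecPred_isSentence.and h)).of_eq
    fun φ => ?_
  exact and_congr_right fun _ => and_congr_right fun hs => (preserved_iff_listHolds hs).symm

/-- Equivalence to a universal sentence is decidable. -/
theorem primrecRel_equivalent (L : Logic) : PrimrecRel fun φ ψ : Formula A =>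
    (φ.InLang L ∧ φ.IsSentence) ∧ (ψ.InUniv L ∧ ψ.IsSentence) ∧ Equivalent.{u, v} φ ψ := by
  have hN : Primrec fun x : Formula A × Formula A => x.1.code + x.2.code :=
    Primrec.nat_add.comp (Primrec.encode.comp Primrec.fst) (Primrec.encode.comp Primrec.snd)
  have h : PrimrecPred fun x : Formula A × Formula A =>
      ∀ l ∈ profileLists A (x.1.code + x.2.code),
        (ListHolds (l, x.1.code + x.2.code) x.1 ↔ ListHolds (l, x.1.code + x.2.code) x.2) := by
    refine primrecPred_forall_mem (primrec_profileLists.comp hN) (PrimrecPred.iff ?_ ?_)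
    · exact primrecRel_listHolds.comp (Primrec.pair Primrec.snd (hN.comp Primrec.fst))
        (Primrec.fst.comp Primrec.fst)
    · exact primrecRel_listHolds.comp (Primrec.pair Primrec.snd (hN.comp Primrec.fst))
        (Primrec.snd.comp Primrec.fst)
  have h' : PrimrecPred fun x : Formula A × Formula A => _ :=
    (((Formula.primrecPred_inLang L).comp Primrec.fst).and
      (Formula.primrecPred_isSentence.comp Primrec.fst)).and
      ((((Formula.primrecPred_inUniv L).comp Primrec.snd).and
        (Formula.primrecPred_isSentence.comp Primrec.snd)).and h)
  refine h'.of_eq fun x => ?_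
  exact and_congr_right fun hφ => and_congr_right fun hψ =>
    (equivalent_iff_listHolds hφ.2 hψ.2).symm

/-- The universal equivalent of a preserved sentence can be found by search. -/
theorem exists_computable_universal (L : Logic) : ∃ t : Formula A → Formula A, Computable t ∧
    ∀ φ : Formula A, φ.InLang L → φ.IsSentence → (t φ).InUniv L ∧ (t φ).IsSentence ∧
      (PreservedUnderSubmodels.{u, v} φ ↔ Equivalent.{u, v} φ (t φ)) := by
  have hR : PrimrecRel fun φ ψ : Formula A =>
      (¬ (φ.InLang L ∧ φ.IsSentence ∧ PreservedUnderSubmodels.{u, v} φ) ∧ ψ = .top) ∨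
      ((φ.InLang L ∧ φ.IsSentence) ∧ (ψ.InUniv L ∧ ψ.IsSentence) ∧ Equivalent.{u, v} φ ψ) :=
    (((primrecPred_preserved.{u, v} L).comp Primrec.fst).not.and
      (Primrec.eq.comp Primrec.snd (Primrec.const Formula.top))).or (primrecRel_equivalent.{u, v} L)
  obtain ⟨t, ht, hRt⟩ := exists_computable_choice hR fun φ => by
    by_cases h : φ.InLang L ∧ φ.IsSentence ∧ PreservedUnderSubmodels.{u, v} φ
    · obtain ⟨ψ, h1, h2, h3⟩ := Formula.exists_inUniv_of_preserved h.1 h.2.1 h.2.2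
      exact ⟨ψ, .inr ⟨⟨h.1, h.2.1⟩, ⟨h1, h2⟩, h3⟩⟩
    · exact ⟨.top, .inl ⟨h, rfl⟩⟩
  refine ⟨t, ht, fun φ hL hs => ?_⟩
  have huniv : (t φ).InUniv L ∧ (t φ).IsSentence := by
    rcases hRt φ with ⟨-, h⟩ | ⟨-, h, -⟩
    · rw [h]
      exact ⟨trivial, rfl⟩
    · exact h
  refine ⟨huniv.1, huniv.2, fun hp => ?_, fun he => ?_⟩
  · rcases hRt φ with ⟨h, -⟩ | ⟨-, -, h⟩
    · exact absurd ⟨hL, hs, hp⟩ h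
    · exact h
  · exact (Formula.preserved_iff_exists_inUniv hL hs).2 ⟨t φ, huniv.1, huniv.2, he⟩

end Evaluation
end MonadicPred
open MonadicPred in
theorem theoremt {A : Type u} [Finite A] [Primcodable A] (L : Logic) :
    (∀ φ : Formula A, φ.InLang L → φ.IsSentence →
      (PreservedUnderSubmodels.{u, v} φ ↔
        ∃ ψ : Formula A, ψ.InUniv L ∧ ψ.IsSentence ∧ Equivalent.{u, v} φ ψ)) ∧
    (∃ t : Formula A → Formula A, Computable t ∧
      ∀ φ : Formula A, φ.InLang L → φ.IsSentence →
        (t φ).InUniv L ∧ (t φ).IsSentence ∧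
        (PreservedUnderSubmodels.{u, v} φ ↔ Equivalent.{u, v} φ (t φ))) ∧
    ComputablePred (fun φ : Formula A =>
      φ.InLang L ∧ φ.IsSentence ∧ PreservedUnderSubmodels.{u, v} φ) := by
  refine ⟨fun φ hL hs => Formula.preserved_iff_exists_inUniv hL hs,
    exists_computable_universal L, ?_⟩
  obtain ⟨hd, h⟩ := primrecPred_preserved.{u, v} (A := A) L
  exact ⟨hd, h.to_comp⟩
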